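/- Let $L>0$, $\Omega=[0,L]^3$ with periodic boundary conditions, $\lambda_1=4\pi^2/L^2$. For an integer $s\ge 0$ let $V_s$ be the space of real, mean-zero, divergence-free vector fields $u=\sum_{K\in\mathbb Z^3\setminus\{0\}}\hat u_K e^{2\pi i K\cdot x/L}$ with $\|u\|_{V_s}^2=L^3\sum_K(2\pi|K|/L)^{2s}|\hat u_K|^2<\infty$; put $H=V_0$, $V=V_1$, $D(A)=V_2$. Let $\|\cdot\|$ and $(\cdot,\cdot)$ be the norm and inner product of $L^2(\Omega)$, so that $\|u\|_{V_1}=\|\nabla u\|$. Let $A=-\Delta$, let $\mathcal P$ be the Helmholtz–Leray projection, $B(u,v)=\mathcal P[(u\cdot\nabla)v]$, and let $P_N$ be the projection onto the Fourier modes $0<|K|<N$. Let $c$ be any constant for which the Gagliardo–Nirenberg inequalities $\|g\|_{L^3}\le c\|g\|^{1/2}\|\nabla g\|^{1/2}$, $\|g\|_{L^4}\le c\|g\|^{1/4}\|\nabla g\|^{3/4}$, $\|g\|_{L^6}\le c\|\nabla g\|$ hold for all $g\in V$. Let $\nu,\alpha,\beta_n,\eta_n>0$, $N_n\in\mathbb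 N$, $f\in L^\infty([0,\infty);H)$ and $0\le t_n\le\hat t_n<t_{n+1}$. Let $u$ be a solution on $[t_n,t_{n+1}]$ of $$\frac{dv}{dt}+\nu Av+B(u,u)=f,\qquad v=u+\alpha^2Au,$$ and $w_n$ a solution on $[t_n,t_{n+1}]$ of $$\frac{dz_n}{dt}+\nu Az_n+B(w_n,w_n)=f-\eta_n(I+\beta_n^2A)\mathcal P(P_{N_n}w_n-P_{N_n}u),\qquad z_n=w_n+\beta_n^2Aw_n.$$ Here a solution is a function in $C([t_n,t_{n+1}];V)\cap L^2(t_n,t_{n+1};D(A))$ with time derivative in $L^2(t_n,t_{n+1};H)$ for which the equation holds in the dual of $D(A)$ for almost every $t$. Put $g_n=w_n-u$, $\psi_n=P_{N_n}(u_t+\nu Au)$ and $$\delta_n=\int_{\hat t_n}^{t_{n+1}}\|\nabla P_{N_n}(u_t-\nu\Delta u)\|^2\,ds,\qquad \tilde\delta_n=\frac{\delta_n}{t_{n+1}-\hat t_n}.$$ Suppose $\delta_n>0$ and let $\beta_{n+1}^2$ denote the real number $$\begin{aligned}\beta_{n+1}^2=\beta_n^2+\frac1{\delta_n}\int_{\hat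 t_n}^{t_{n+1}}\Big[&\big(\tfrac{d}{dt}P_{N_n}g_n,\psi_n\big)+\beta_n^2\big(\tfrac{d}{dt}\nabla P_{N_n}g_n,\nabla\psi_n\big)+\nu(\nabla P_{N_n}g_n,\nabla\psi_n)+\nu\beta_n^2(\nabla AP_{N_n}g_n,\nabla\psi_n)\\&+\big(P_{N_n}B(w_n,w_n)-P_{N_n}B(w_n-P_{N_n}g_n,w_n-P_{N_n}g_n),\psi_n\big)\\&+\eta_n(P_{N_n}g_n,\psi_n)+\beta_n^2\eta_n(\nabla P_{N_n}g_n,\nabla\psi_n)\Big]ds.\end{aligned}$$ Then $$|\alpha^2-\beta_{n+1}^2|\le\frac{4c^2\lambda_1^{-1/4}}{\tilde\delta_n^{1/2}N_n^{1/2}}\sup_{\hat t_n\le s\le t_{n+1}}\big\{(\|\nabla w_n(s)\|+\|\nabla u(s)\|)\|\nabla g_n(s)\|\big\},$$ and moreover $$\begin{aligned}\alpha^2-\beta_{n+1}^2=\frac1{\delta_n}\int_{\hat t_n}^{t_{n+1}}\Big[&(P_{N_n}B(g_n-P_{N_n}g_n,w_n),\psi_n)+(P_{N_n}B(w_n,g_n-P_{N_n}g_n),\psi_n)\\&+(P_{N_n}B(P_{N_n}g_n-g_n,P_{N_n}g_n),\psi_n)+(P_{N_n}B(g_n,P_{N_n}g_n-g_n),\psi_n)\Big]ds.\end{aligned}$$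 -/

import Mathlib

noncomputable section

namespace Bardina

open MeasureTheory Filter Topology

/-- A vector field on the periodic box `[0,L]³`, given by its Fourier coefficients:
`û` stands for `x ↦ ∑_K û_K exp (2πi K·x / L)`. -/
abbrev Coeff : Type := (Fin 3 → ℤ) → EuclideanSpace ℂ (Fin 3)

/-- `|K|²`. -/
def normSq (K : Fin 3 → ℤ) : ℝ := ∑ j, (K j : ℝ) ^ 2

/-- `(2π|K|/L)² = 4π²|K|²/L²`, the eigenvalue of `A = -Δ` on the `K`-th mode. -/
def lam (L : ℝ) (K : Fin 3 → ℤ) : ℝ := 4 * Real.pi ^ 2 * normSq K / L ^ 2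

/-- `λ₁ = 4π²/L²`. -/
def lam1 (L : ℝ) : ℝ := 4 * Real.pi ^ 2 / L ^ 2

/-- The bilinear (not sesquilinear) product `a · K` of a complex vector and a wave number. -/
def dotK (a : EuclideanSpace ℂ (Fin 3)) (K : Fin 3 → ℤ) : ℂ := ∑ j, a j * (K j : ℂ)

/-- The space `V_s` of real, mean-zero, divergence-free fields with `∑ |K|^(2s) |û_K|² < ∞`.
`H = V_0`, `V = V_1`, `D(A) = V_2`. -/
def VSpace (s : ℕ) : Set Coeff :=
  {u | u 0 = 0 ∧ (∀ K j, u (-K) j = starRingEnd ℂ (u K j)) ∧ (∀ K, dotK (u K) K = 0) ∧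
    Summable fun K => normSq K ^ s * ‖u K‖ ^ 2}

/-- `‖u‖_{V_s}`; for `s = 0, 1, 2` these are `‖u‖`, `‖∇u‖`, `‖Au‖`, the norms being those of
`L²([0,L]³)`. -/
def sNorm (L : ℝ) (s : ℕ) (u : Coeff) : ℝ :=
  Real.sqrt (L ^ 3 * ∑' K, lam L K ^ s * ‖u K‖ ^ 2)

/-- `(u, v)_{V_s}`; for `s = 0, 1` these are the `L²([0,L]³)` products `(u, v)` and `(∇u, ∇v)`.
For real fields the sum without the real part is real already. -/
def sInner (L : ℝ) (s : ℕ) (u v : Coeff) : ℝ :=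
  L ^ 3 * ∑' K, lam L K ^ s * (∑ j, u K j * starRingEnd ℂ (v K j)).re

/-- The Stokes operator `A = -Δ`. -/
def stokes (L : ℝ) (u : Coeff) : Coeff := fun K => lam L K • u K

/-- The Helmholtz-Leray projection. -/
def leray (u : Coeff) : Coeff := fun K =>
  if K = 0 then 0
  else u K - (dotK (u K) K / (normSq K : ℂ)) • WithLp.toLp 2 (fun j => (K j : ℂ))

open Classical in
/-- The projection `P_N` onto the modes `0 < |K| < N`. -/
def proj (N : ℕ) (u : Coeff) : Coeff := fun K =>
  if 0 < Real.sqrt (normSq K) ∧ Real.sqrt (normSq K) < N then u K else 0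

/-- `(u·∇)v`: its `K`-th Fourier coefficient is `∑_J (û_J · (2πi/L) (K - J)) v̂_{K-J}`. -/
def advect (L : ℝ) (u v : Coeff) : Coeff := fun K =>
  ∑' J, (2 * Real.pi * Complex.I / L * dotK (u J) (K - J)) • v (K - J)

/-- `B(u,v)`, the Leray projection of `(u·∇)v`. -/
def bilin (L : ℝ) (u v : Coeff) : Coeff := leray (advect L u v)

/-- The time derivative, mode by mode. -/
def timeDeriv (u : ℝ → Coeff) (t : ℝ) : Coeff := fun K => deriv (fun s => u s K) t

/-- `f ∈ L^∞([0,∞); H)`. -/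
structure IsForcing (L : ℝ) (f : ℝ → Coeff) : Prop where
  meas : ∀ K, AEStronglyMeasurable (fun t => f t K) (volume.restrict (Set.Ici 0))
  mem : ∀ᵐ t ∂volume.restrict (Set.Ici (0 : ℝ)), f t ∈ VSpace 0
  bound : ∃ M : ℝ, ∀ᵐ t ∂volume.restrict (Set.Ici (0 : ℝ)), sNorm L 0 (f t) ≤ M

/-- The regularity class of solutions on `[a,b]`:
`u ∈ C([a,b]; V) ∩ L²(a,b; D(A))` and `u_t ∈ L²(a,b; H)`. The fields `deriv_int` and `ftc` say that
each mode is absolutely continuous, so that `timeDeriv u` is the weak time derivative `u_t`. In this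
class all the time integrals below converge. -/
structure IsRegular (L a b : ℝ) (u : ℝ → Coeff) : Prop where
  mem_V : ∀ t ∈ Set.Icc a b, u t ∈ VSpace 1
  cont_V : ∀ t ∈ Set.Icc a b,
    Tendsto (fun s => sNorm L 1 (u s - u t)) (𝓝[Set.Icc a b] t) (𝓝 0)
  mem_DA : ∀ᵐ t ∂volume.restrict (Set.Icc a b), u t ∈ VSpace 2
  sq_int_DA : IntegrableOn (fun t => sNorm L 2 (u t) ^ 2) (Set.Icc a b)
  deriv_int : ∀ K, IntervalIntegrable (fun t => timeDeriv u t K) volume a b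
  ftc : ∀ K, ∀ t ∈ Set.Icc a b, u t K = u a K + ∫ s in a..t, timeDeriv u s K
  deriv_mem_H : ∀ᵐ t ∂volume.restrict (Set.Icc a b), timeDeriv u t ∈ VSpace 0
  sq_int_deriv : IntegrableOn (fun t => sNorm L 0 (timeDeriv u t) ^ 2) (Set.Icc a b)

/-- The filtered-to-unfiltered map `(I + α²A) u`. -/
def helm (L α : ℝ) (u : Coeff) : Coeff := u + α ^ 2 • stokes L u

/-- `u` solves `dv/dt + νAv + B(u,u) = f`, `v = u + α²Au`, on `[a,b]`. The equation is an equality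
in the dual of `D(A)`, that is, an equality of Fourier coefficients, at almost every time. -/
structure IsBardinaSolution (L ν α : ℝ) (f : ℝ → Coeff) (a b : ℝ) (u : ℝ → Coeff) : Prop where
  regular : IsRegular L a b u
  eqn : ∀ᵐ t ∂volume.restrict (Set.Icc a b),
    timeDeriv (fun s => helm L α (u s)) t + ν • stokes L (helm L α (u t))
      + bilin L (u t) (u t) = f t

/-- `w` solves the nudged system `dz/dt + νAz + B(w,w) = f - η(I + β²A)𝒫(P_N w - P_N u)`,
`z = w + β²Aw`, on `[a,b]`, where `𝒫` is the Leray projection. -/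
structure IsNudgedSolution (L ν β η : ℝ) (N : ℕ) (f u : ℝ → Coeff) (a b : ℝ)
    (w : ℝ → Coeff) : Prop where
  regular : IsRegular L a b w
  eqn : ∀ᵐ t ∂volume.restrict (Set.Icc a b),
    timeDeriv (fun s => helm L β (w s)) t + ν • stokes L (helm L β (w t))
      + bilin L (w t) (w t)
      = f t - η • helm L β (leray (proj N (w t) - proj N (u t)))

/-- `P_N (u_t + νAu)` at time `t`. -/
def resid (L ν : ℝ) (N : ℕ) (u : ℝ → Coeff) (t : ℝ) : Coeff :=
  proj N (timeDeriv u t + ν • stokes L (u t))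

/-- `δ = ∫_τ^T ‖∇P_N(u_t - νΔu)‖² ds` (recall `A = -Δ`). -/
def delta (L ν : ℝ) (N : ℕ) (u : ℝ → Coeff) (τ T : ℝ) : ℝ :=
  ∫ s in τ..T, sNorm L 1 (resid L ν N u s) ^ 2

/-- The value that the recovery algorithm assigns to the square of the next parameter; `β` is the
current parameter and `g = w - u`. -/
def updatedBetaSq (L ν β η : ℝ) (N : ℕ) (u w : ℝ → Coeff) (τ T : ℝ) : ℝ :=
  let g : ℝ → Coeff := fun s => w s - u s
  let Pg : ℝ → Coeff := fun s => proj N (g s)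
  let r : ℝ → Coeff := resid L ν N u
  β ^ 2 + 1 / delta L ν N u τ T * ∫ s in τ..T,
    (sInner L 0 (timeDeriv Pg s) (r s)
      + β ^ 2 * sInner L 1 (timeDeriv Pg s) (r s)
      + ν * sInner L 1 (Pg s) (r s)
      + ν * β ^ 2 * sInner L 1 (stokes L (Pg s)) (r s)
      + sInner L 0 (proj N (bilin L (w s) (w s))
          - proj N (bilin L (w s - Pg s) (w s - Pg s))) (r s)
      + η * sInner L 0 (Pg s) (r s)
      + β ^ 2 * η * sInner L 1 (Pg s) (r s))

/-- The probability Haar measure of the unit torus (the one used for its Fourier coefficients). -/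
def torusMeasure : Measure (UnitAddTorus (Fin 3)) := Measure.pi fun _ => AddCircle.haarAddCircle

/-- Fourier coefficients of a real vector field on the torus. The box `[0,L]³` is parametrised by
the unit torus through `x = L y`, so `G y` stands for the value of the field at `L y`. -/
def fieldCoeff (G : UnitAddTorus (Fin 3) → EuclideanSpace ℝ (Fin 3)) : Coeff := fun K =>
  WithLp.toLp 2 fun j => UnitAddTorus.mFourierCoeff (fun y => ((G y j : ℝ) : ℂ)) K

/-- The norm of `L^p([0,L]³)` of the field `x ↦ G (x / L)`; the change of variables `x = L y` gives
the factor `L^(3/p)`. -/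
def boxLpNorm (L : ℝ) (p : ℕ) (G : UnitAddTorus (Fin 3) → EuclideanSpace ℝ (Fin 3)) : ENNReal :=
  ENNReal.ofReal (L ^ ((3 : ℝ) / p)) * eLpNorm G p torusMeasure

/-- `c` is a constant for which, on the box `[0,L]³` and for every `g ∈ V`,
`‖g‖_{L³} ≤ c ‖g‖^(1/2) ‖∇g‖^(1/2)`, `‖g‖_{L⁴} ≤ c ‖g‖^(1/4) ‖∇g‖^(3/4)` and
`‖g‖_{L⁶} ≤ c ‖∇g‖`. -/
def IsGagliardoNirenbergConst (L c : ℝ) : Prop :=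
  ∀ G : UnitAddTorus (Fin 3) → EuclideanSpace ℝ (Fin 3), MemLp G 2 torusMeasure →
    fieldCoeff G ∈ VSpace 1 →
    boxLpNorm L 3 G ≤ ENNReal.ofReal
        (c * sNorm L 0 (fieldCoeff G) ^ (1 / 2 : ℝ) * sNorm L 1 (fieldCoeff G) ^ (1 / 2 : ℝ)) ∧
    boxLpNorm L 4 G ≤ ENNReal.ofReal
        (c * sNorm L 0 (fieldCoeff G) ^ (1 / 4 : ℝ) * sNorm L 1 (fieldCoeff G) ^ (3 / 4 : ℝ)) ∧
    boxLpNorm L 6 G ≤ ENNReal.ofReal (c * sNorm L 1 (fieldCoeff G))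

end Bardina

end

open Bardina

noncomputable section

namespace Bardina

open MeasureTheory Filter Topology
open UnitAddTorus (mFourier mFourierCoeff)
open scoped ComplexConjugate

/-! ### Wave numbers -/

lemma normSq_nonneg (K : Fin 3 → ℤ) : 0 ≤ normSq K :=
  Finset.sum_nonneg fun _ _ => sq_nonneg _

lemma normSq_neg (K : Fin 3 → ℤ) : normSq (-K) = normSq K := by simp [normSq]

lemma normSq_zero : normSq 0 = 0 := by simp [normSq]

lemma one_le_normSq {K : Fin 3 → ℤ} (hK : K ≠ 0) : 1 ≤ normSq K := by
  obtain ⟨j, hj⟩ := Function.ne_iff.1 hK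
  have h1 : (1 : ℝ) ≤ (K j : ℝ) ^ 2 := by
    have : (1 : ℤ) ≤ (K j) ^ 2 := by
      have := sq_pos_of_ne_zero (show K j ≠ 0 from hj)
      omega
    exact_mod_cast this
  exact h1.trans (Finset.single_le_sum (f := fun j => (K j : ℝ) ^ 2)
    (fun _ _ => sq_nonneg _) (Finset.mem_univ j))

lemma lam_eq (L : ℝ) (K : Fin 3 → ℤ) : lam L K = lam1 L * normSq K := by
  simp only [lam, lam1]; ring

lemma lam1_pos {L : ℝ} (hL : 0 < L) : 0 < lam1 L := by
  unfold lam1; positivity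

lemma lam_nonneg (L : ℝ) (K : Fin 3 → ℤ) : 0 ≤ lam L K := by
  have := normSq_nonneg K
  unfold lam; positivity

/-- The wave number `K` as a complex vector. -/
def waveVec (K : Fin 3 → ℤ) : EuclideanSpace ℂ (Fin 3) := WithLp.toLp 2 fun j => (K j : ℂ)

lemma norm_waveVec_sq (K : Fin 3 → ℤ) : ‖waveVec K‖ ^ 2 = normSq K := by
  simp [waveVec, EuclideanSpace.norm_sq_eq, normSq]

lemma dotK_eq_inner (a : EuclideanSpace ℂ (Fin 3)) (K : Fin 3 → ℤ) :
    dotK a K = inner ℂ (waveVec K) a := by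
  simp [dotK, waveVec, PiLp.inner_apply]

lemma norm_dotK_le (a : EuclideanSpace ℂ (Fin 3)) (K : Fin 3 → ℤ) :
    ‖dotK a K‖ ≤ ‖waveVec K‖ * ‖a‖ := by
  rw [dotK_eq_inner]; exact norm_inner_le_norm _ _

lemma dotK_add (a b : EuclideanSpace ℂ (Fin 3)) (K : Fin 3 → ℤ) :
    dotK (a + b) K = dotK a K + dotK b K := by
  simp [dotK_eq_inner]

lemma dotK_neg (a : EuclideanSpace ℂ (Fin 3)) (K : Fin 3 → ℤ) : dotK (-a) K = -dotK a K := by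
  simp [dotK_eq_inner]

lemma dotK_real_smul (c : ℝ) (a : EuclideanSpace ℂ (Fin 3)) (K : Fin 3 → ℤ) :
    dotK (c • a) K = c * dotK a K := by
  simp [dotK, Finset.mul_sum, mul_assoc]

/-! ### The spaces `V_s` -/

namespace VSpace

variable {s : ℕ} {u v : Coeff}

lemma add (hu : u ∈ VSpace s) (hv : v ∈ VSpace s) : u + v ∈ VSpace s := by
  refine ⟨by simp [hu.1, hv.1], fun K j => by simp [hu.2.1 K j, hv.2.1 K j],
    fun K => by simp [dotK_add, hu.2.2.1 K, hv.2.2.1 K], ?_⟩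
  refine Summable.of_nonneg_of_le (fun K => mul_nonneg (pow_nonneg (normSq_nonneg K) _)
    (sq_nonneg _)) (fun K => ?_) ((hu.2.2.2.add hv.2.2.2).mul_left 2)
  have h1 : ‖(u + v) K‖ ≤ ‖u K‖ + ‖v K‖ := norm_add_le _ _
  have h2 : ‖(u + v) K‖ ^ 2 ≤ 2 * (‖u K‖ ^ 2 + ‖v K‖ ^ 2) := by
    nlinarith [norm_nonneg ((u + v) K), sq_nonneg (‖u K‖ - ‖v K‖)]
  calc _ ≤ normSq K ^ s * (2 * (‖u K‖ ^ 2 + ‖v K‖ ^ 2)) :=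
        mul_le_mul_of_nonneg_left h2 (pow_nonneg (normSq_nonneg K) _)
    _ = _ := by ring

lemma real_smul (c : ℝ) (hu : u ∈ VSpace s) : c • u ∈ VSpace s := by
  refine ⟨by simp [hu.1], fun K j => by simp [hu.2.1 K j],
    fun K => by simp [dotK_real_smul, hu.2.2.1 K], ?_⟩
  refine (hu.2.2.2.mul_left (c ^ 2)).congr fun K => ?_
  simp only [Pi.smul_apply, norm_smul, mul_pow, Real.norm_eq_abs, sq_abs]; ring

lemma neg (hu : u ∈ VSpace s) : -u ∈ VSpace s := by
  simpa using real_smul (-1) hu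

lemma sub (hu : u ∈ VSpace s) (hv : v ∈ VSpace s) : u - v ∈ VSpace s := by
  rw [sub_eq_add_neg]; exact add hu (neg hv)

lemma proj (N : ℕ) (hu : u ∈ VSpace s) : proj N u ∈ VSpace s := by
  refine ⟨by simp [Bardina.proj, hu.1], fun K j => ?_, fun K => ?_, ?_⟩
  · simp only [Bardina.proj, normSq_neg]
    split_ifs <;> simp [hu.2.1 K j]
  · simp only [Bardina.proj]
    split_ifs
    · exact hu.2.2.1 K
    · simp [dotK]
  · refine Summable.of_nonneg_of_le (fun K => mul_nonneg (pow_nonneg (normSq_nonneg K) _)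
      (sq_nonneg _)) (fun K => mul_le_mul_of_nonneg_left ?_ (pow_nonneg (normSq_nonneg K) _))
      hu.2.2.2
    simp only [Bardina.proj]
    split_ifs
    · exact le_rfl
    · simp

lemma summable_norm_sq (hu : u ∈ VSpace s) : Summable fun K => ‖u K‖ ^ 2 := by
  refine Summable.of_nonneg_of_le (fun K => sq_nonneg _) (fun K => ?_) hu.2.2.2
  by_cases hK : K = 0
  · subst hK; simp [hu.1, normSq_zero]
  · exact le_mul_of_one_le_left (sq_nonneg _) (one_le_pow₀ (one_le_normSq hK))

lemma summable_lam (L : ℝ) (hu : u ∈ VSpace s) : Summable fun K => lam L K ^ s * ‖u K‖ ^ 2 := by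
  refine (hu.2.2.2.mul_left (lam1 L ^ s)).congr fun K => ?_
  rw [lam_eq, mul_pow, mul_assoc]

lemma mem_zero (hu : u ∈ VSpace s) : u ∈ VSpace 0 :=
  ⟨hu.1, hu.2.1, hu.2.2.1, by simpa using summable_norm_sq hu⟩

/-- A field with finitely many modes belongs to all spaces of the scale. -/
lemma of_finite_support {S : Finset (Fin 3 → ℤ)} (hu : u ∈ VSpace s) (hS : ∀ K ∉ S, u K = 0)
    (s' : ℕ) : u ∈ VSpace s' :=
  ⟨hu.1, hu.2.1, hu.2.2.1, summable_of_ne_finset_zero (s := S) fun K hK => by simp [hS K hK]⟩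

end VSpace

lemma sNorm_nonneg (L : ℝ) (s : ℕ) (u : Coeff) : 0 ≤ sNorm L s u := Real.sqrt_nonneg _

lemma sNorm_sq {L : ℝ} (hL : 0 < L) (s : ℕ) (u : Coeff) :
    sNorm L s u ^ 2 = L ^ 3 * ∑' K, lam L K ^ s * ‖u K‖ ^ 2 :=
  Real.sq_sqrt (mul_nonneg (by positivity)
    (tsum_nonneg fun K => mul_nonneg (pow_nonneg (lam_nonneg L K) _) (sq_nonneg _)))

lemma sNorm_neg (L : ℝ) (s : ℕ) (u : Coeff) : sNorm L s (-u) = sNorm L s u := by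
  simp [sNorm]

lemma sNorm_sub_comm (L : ℝ) (s : ℕ) (u v : Coeff) : sNorm L s (u - v) = sNorm L s (v - u) := by
  rw [← neg_sub, sNorm_neg]

lemma sNorm_mono {L : ℝ} (hL : 0 < L) {s : ℕ} {u v : Coeff} (hu : u ∈ VSpace s)
    (h : ∀ K, ‖v K‖ ≤ ‖u K‖) : sNorm L s v ≤ sNorm L s u := by
  have h1 : ∀ K, lam L K ^ s * ‖v K‖ ^ 2 ≤ lam L K ^ s * ‖u K‖ ^ 2 := fun K =>
    mul_le_mul_of_nonneg_left (pow_le_pow_left₀ (norm_nonneg _) (h K) 2)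
      (pow_nonneg (lam_nonneg L K) _)
  refine Real.sqrt_le_sqrt (mul_le_mul_of_nonneg_left ?_ (by positivity))
  exact Summable.tsum_le_tsum h1 (Summable.of_nonneg_of_le (fun K =>
    mul_nonneg (pow_nonneg (lam_nonneg L K) _) (sq_nonneg _)) h1 (VSpace.summable_lam L hu))
    (VSpace.summable_lam L hu)

lemma sNorm_add_le {L : ℝ} (hL : 0 < L) {s : ℕ} {u v : Coeff} (hu : u ∈ VSpace s)
    (hv : v ∈ VSpace s) : sNorm L s (u + v) ≤ sNorm L s u + sNorm L s v := by
  have key : ∀ (x : Coeff) K, (Real.sqrt (lam L K ^ s) * ‖x K‖) ^ (2 : ℝ)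
      = lam L K ^ s * ‖x K‖ ^ 2 := fun x K => by
    rw [Real.rpow_two, mul_pow, Real.sq_sqrt (pow_nonneg (lam_nonneg L K) _)]
  obtain ⟨h1, h2⟩ := Real.Lp_add_le_tsum_of_nonneg (p := 2) (by norm_num)
    (f := fun K => Real.sqrt (lam L K ^ s) * ‖u K‖) (g := fun K => Real.sqrt (lam L K ^ s) * ‖v K‖)
    (fun K => by positivity) (fun K => by positivity)
    ((VSpace.summable_lam L hu).congr fun K => (key u K).symm)
    ((VSpace.summable_lam L hv).congr fun K => (key v K).symm)
  simp only [key, ← Real.sqrt_eq_rpow] at h2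
  simp only [sNorm, Real.sqrt_mul (pow_nonneg hL.le 3)]
  rw [← mul_add]
  refine mul_le_mul_of_nonneg_left (le_trans (Real.sqrt_le_sqrt ?_) h2) (Real.sqrt_nonneg _)
  refine Summable.tsum_le_tsum (fun K => ?_) (VSpace.summable_lam L (VSpace.add hu hv)) h1
  rw [← key]
  refine Real.rpow_le_rpow (by positivity) ?_ (by norm_num)
  rw [← mul_add]
  exact mul_le_mul_of_nonneg_left (norm_add_le _ _) (Real.sqrt_nonneg _)

lemma sNorm_sub_le {L : ℝ} (hL : 0 < L) {s : ℕ} {u v : Coeff} (hu : u ∈ VSpace s)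
    (hv : v ∈ VSpace s) : sNorm L s (u - v) ≤ sNorm L s u + sNorm L s v := by
  rw [sub_eq_add_neg, ← sNorm_neg L s v]; exact sNorm_add_le hL hu (VSpace.neg hv)

lemma abs_sNorm_sub_sNorm_le {L : ℝ} (hL : 0 < L) {s : ℕ} {u v : Coeff} (hu : u ∈ VSpace s)
    (hv : v ∈ VSpace s) : |sNorm L s u - sNorm L s v| ≤ sNorm L s (u - v) := by
  have h1 := sNorm_add_le hL (VSpace.sub hu hv) hv
  have h2 := sNorm_add_le hL (VSpace.sub hv hu) hu
  rw [sub_add_cancel] at h1 h2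
  rw [sNorm_sub_comm] at h2
  exact abs_le.2 ⟨by linarith, by linarith⟩

/-! ### Spectral projections -/

lemma norm_proj_le (N : ℕ) (u : Coeff) (K : Fin 3 → ℤ) : ‖proj N u K‖ ≤ ‖u K‖ := by
  simp only [proj]; split_ifs <;> simp

lemma norm_sub_proj_le (N : ℕ) (u : Coeff) (K : Fin 3 → ℤ) : ‖(u - proj N u) K‖ ≤ ‖u K‖ := by
  simp only [Pi.sub_apply, proj]; split_ifs <;> simp

/-- The high-mode Poincaré inequality, in the form in which it enters interpolation estimates. -/
lemma interpolation_sub_proj_le {L : ℝ} (hL : 0 < L) {N : ℕ} (hN : 0 < N) {g : Coeff}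
    (hg : g ∈ VSpace 1) :
    sNorm L 0 (g - proj N g) ^ (1 / 2 : ℝ) * sNorm L 1 (g - proj N g) ^ (1 / 2 : ℝ)
      ≤ lam1 L ^ (-(1 / 4) : ℝ) / (N : ℝ) ^ (1 / 2 : ℝ) * sNorm L 1 g := by
  set q := g - proj N g with hq
  have hqV : q ∈ VSpace 1 := VSpace.sub hg (VSpace.proj N hg)
  have hl := lam1_pos hL
  have hN' : (0 : ℝ) < N := by exact_mod_cast hN
  have hP : lam1 L * (N : ℝ) ^ 2 * sNorm L 0 q ^ 2 ≤ sNorm L 1 q ^ 2 := by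
    rw [sNorm_sq hL, sNorm_sq hL, mul_left_comm, ← tsum_mul_left]
    refine mul_le_mul_of_nonneg_left (Summable.tsum_le_tsum (fun K => ?_)
      ((VSpace.summable_lam L (VSpace.mem_zero hqV)).mul_left _) (VSpace.summable_lam L hqV))
      (by positivity)
    by_cases hK : q K = 0
    · simp [hK]
    · simp only [pow_zero, one_mul, pow_one]
      refine mul_le_mul_of_nonneg_right ?_ (sq_nonneg _)
      rw [lam_eq]
      refine mul_le_mul_of_nonneg_left ?_ hl.le
      have hK0 : K ≠ 0 := by rintro rfl; exact hK hqV.1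
      by_contra! hlt
      apply hK
      have h1 : 0 < Real.sqrt (normSq K) :=
        Real.sqrt_pos.2 (lt_of_lt_of_le one_pos (one_le_normSq hK0))
      have h2 : Real.sqrt (normSq K) < N := (Real.sqrt_lt' hN').2 hlt
      simp only [hq, proj, Pi.sub_apply, if_pos (And.intro h1 h2), sub_self]
  have hP' : lam1 L ^ (1 / 2 : ℝ) * N * sNorm L 0 q ≤ sNorm L 1 q := by
    refine le_of_sq_le_sq ?_ (sNorm_nonneg _ _ _)
    refine le_trans (le_of_eq ?_) hP
    rw [mul_pow, mul_pow, ← Real.sqrt_eq_rpow, Real.sq_sqrt hl.le]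
  have hle : sNorm L 1 q ≤ sNorm L 1 g := sNorm_mono hL hg (norm_sub_proj_le N g)
  refine le_trans ?_ (mul_le_mul_of_nonneg_left hle (by positivity))
  have hX := sNorm_nonneg L 0 q
  have hY := sNorm_nonneg L 1 q
  have h3 : (lam1 L ^ (1 / 2 : ℝ) * N * sNorm L 0 q) ^ (1 / 2 : ℝ) ≤ sNorm L 1 q ^ (1 / 2 : ℝ) :=
    Real.rpow_le_rpow (by positivity) hP' (by norm_num)
  rw [Real.mul_rpow (by positivity) hX, Real.mul_rpow (by positivity) (by positivity),
    ← Real.rpow_mul hl.le] at h3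
  have h4 : sNorm L 1 q = sNorm L 1 q ^ (1 / 2 : ℝ) * sNorm L 1 q ^ (1 / 2 : ℝ) := by
    rw [← Real.sqrt_eq_rpow, Real.mul_self_sqrt hY]
  have h5 : lam1 L ^ (-(1 / 4) : ℝ) = (lam1 L ^ (1 / 4 : ℝ))⁻¹ := Real.rpow_neg hl.le _
  have h6 : (1 / 2 : ℝ) * (1 / 2) = 1 / 4 := by norm_num
  rw [h6] at h3
  conv_rhs => rw [h4, ← mul_assoc]
  refine mul_le_mul_of_nonneg_right ?_ (by positivity)
  rw [h5, ← one_div, div_div, div_mul_eq_mul_div, one_mul, le_div_iff₀ (by positivity)]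
  linarith

/-- A finite set containing all modes with `|K| < N`. -/
def lowModes (N : ℕ) : Finset (Fin 3 → ℤ) := Finset.Icc (fun _ => -(N : ℤ)) (fun _ => (N : ℤ))

lemma proj_eq_zero_of_notMem {N : ℕ} {K : Fin 3 → ℤ} (hK : K ∉ lowModes N) (u : Coeff) :
    proj N u K = 0 := by
  refine if_neg fun h => hK ?_
  have hN : (0 : ℝ) ≤ N := Nat.cast_nonneg N
  have h1 : normSq K < (N : ℝ) ^ 2 := by
    rw [← Real.sqrt_lt_sqrt_iff (normSq_nonneg K), Real.sqrt_sq hN]; exact h.2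
  have h2 : ∀ j, |K j| ≤ (N : ℤ) := fun j => by
    have : (K j : ℝ) ^ 2 ≤ normSq K := Finset.single_le_sum (f := fun j => (K j : ℝ) ^ 2)
      (fun _ _ => sq_nonneg _) (Finset.mem_univ j)
    have h3 : |(K j : ℝ)| ≤ N := abs_le_of_sq_le_sq (this.trans h1.le) hN
    exact_mod_cast h3
  exact Finset.mem_Icc.2 ⟨fun j => (abs_le.1 (h2 j)).1, fun j => (abs_le.1 (h2 j)).2⟩

/-! ### Inner products with fields that have finitely many modes -/

lemma sInner_eq_sum {S : Finset (Fin 3 → ℤ)} {r : Coeff} (hS : ∀ K ∉ S, r K = 0) (L : ℝ) (s : ℕ)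
    (X : Coeff) :
    sInner L s X r = L ^ 3 * ∑ K ∈ S, lam L K ^ s * (inner ℂ (r K) (X K)).re := by
  simp only [sInner]
  rw [tsum_eq_sum (s := S) fun K hK => by simp [hS K hK]]
  simp [PiLp.inner_apply]

lemma sNorm_sq_eq_sum {S : Finset (Fin 3 → ℤ)} {r : Coeff} (hS : ∀ K ∉ S, r K = 0) {L : ℝ}
    (hL : 0 < L) (s : ℕ) :
    sNorm L s r ^ 2 = L ^ 3 * ∑ K ∈ S, lam L K ^ s * ‖r K‖ ^ 2 := by
  rw [sNorm_sq hL, tsum_eq_sum (s := S) fun K hK => by simp [hS K hK]]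

lemma sInner_proj_left {N : ℕ} {X r : Coeff} (hr : ∀ K, r K ≠ 0 → ∀ Y : Coeff, proj N Y K = Y K)
    (L : ℝ) (s : ℕ) : sInner L s (proj N X) r = sInner L s X r := by
  simp only [sInner]
  congr 1
  refine tsum_congr fun K => ?_
  by_cases hK : r K = 0
  · simp [hK]
  · rw [hr K hK]

lemma inner_leray {r : Coeff} (h0 : r 0 = 0) (hdiv : ∀ K, dotK (r K) K = 0) (X : Coeff)
    (K : Fin 3 → ℤ) : inner ℂ (r K) (leray X K) = inner ℂ (r K) (X K) := by
  by_cases hK : K = 0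
  · subst hK; simp [h0]
  · have h1 : inner ℂ (r K) (waveVec K) = 0 := by
      rw [← inner_conj_symm, ← dotK_eq_inner, hdiv]; simp
    simp only [leray, if_neg hK, inner_sub_right, inner_smul_right]
    change _ - _ * inner ℂ (r K) (waveVec K) = _
    rw [h1]; simp

lemma leray_of_mem {s : ℕ} {u : Coeff} (hu : u ∈ VSpace s) : leray u = u := by
  funext K
  by_cases hK : K = 0
  · subst hK; simp [leray, hu.1]
  · simp [leray, hK, hu.2.2.1 K]

lemma leray_add (u v : Coeff) : leray (u + v) = leray u + leray v := by
  funext K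
  by_cases hK : K = 0
  · simp [leray, hK]
  · simp only [leray, hK, if_false, Pi.add_apply, dotK_add, add_div, add_smul]; abel

lemma leray_neg (u : Coeff) : leray (-u) = -leray u := by
  funext K
  by_cases hK : K = 0
  · simp [leray, hK]
  · simp only [leray, hK, if_false, Pi.neg_apply, dotK_neg, neg_div, neg_smul]; abel

/-! ### The bilinear form -/

lemma summable_advect (L : ℝ) {u v : Coeff} (hu : u ∈ VSpace 1) (hv : v ∈ VSpace 1)
    (K : Fin 3 → ℤ) :
    Summable fun J => (2 * Real.pi * Complex.I / L * dotK (u J) (K - J)) • v (K - J) := by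
  have hv' : Summable fun J => normSq (K - J) * ‖v (K - J)‖ ^ 2 := by
    have := hv.2.2.2
    simp only [pow_one] at this
    exact (Equiv.subLeft K).summable_iff.2 this
  refine Summable.of_norm_bounded
    (((VSpace.summable_norm_sq hu).add hv').mul_left ‖(2 * Real.pi * Complex.I / L : ℂ)‖) fun J => ?_
  rw [norm_smul, norm_mul, mul_assoc]
  refine mul_le_mul_of_nonneg_left ?_ (norm_nonneg _)
  rw [← norm_waveVec_sq]
  calc _ ≤ ‖waveVec (K - J)‖ * ‖u J‖ * ‖v (K - J)‖ :=
        mul_le_mul_of_nonneg_right (norm_dotK_le _ _) (norm_nonneg _)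
    _ ≤ _ := by
        nlinarith [sq_nonneg (‖u J‖ - ‖waveVec (K - J)‖ * ‖v (K - J)‖), sq_nonneg ‖u J‖,
          sq_nonneg (‖waveVec (K - J)‖ * ‖v (K - J)‖)]

lemma advect_add_left (L : ℝ) {u u' v : Coeff} (hu : u ∈ VSpace 1) (hu' : u' ∈ VSpace 1)
    (hv : v ∈ VSpace 1) : advect L (u + u') v = advect L u v + advect L u' v := by
  funext K
  simp only [advect, Pi.add_apply, dotK_add, mul_add, add_smul]
  exact (summable_advect L hu hv K).tsum_add (summable_advect L hu' hv K)

lemma advect_add_right (L : ℝ) {u v v' : Coeff} (hu : u ∈ VSpace 1) (hv : v ∈ VSpace 1)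
    (hv' : v' ∈ VSpace 1) : advect L u (v + v') = advect L u v + advect L u v' := by
  funext K
  simp only [advect, Pi.add_apply, smul_add]
  exact (summable_advect L hu hv K).tsum_add (summable_advect L hu hv' K)

lemma advect_neg_left (L : ℝ) (u v : Coeff) : advect L (-u) v = -advect L u v := by
  funext K
  simp only [advect, Pi.neg_apply, dotK_neg, mul_neg, neg_smul, tsum_neg]

lemma advect_neg_right (L : ℝ) (u v : Coeff) : advect L u (-v) = -advect L u v := by
  funext K
  simp only [advect, Pi.neg_apply, smul_neg, tsum_neg]

lemma bilin_add_left (L : ℝ) {u u' v : Coeff} (hu : u ∈ VSpace 1) (hu' : u' ∈ VSpace 1)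
    (hv : v ∈ VSpace 1) : bilin L (u + u') v = bilin L u v + bilin L u' v := by
  rw [bilin, advect_add_left L hu hu' hv, leray_add]; rfl

lemma bilin_add_right (L : ℝ) {u v v' : Coeff} (hu : u ∈ VSpace 1) (hv : v ∈ VSpace 1)
    (hv' : v' ∈ VSpace 1) : bilin L u (v + v') = bilin L u v + bilin L u v' := by
  rw [bilin, advect_add_right L hu hv hv', leray_add]; rfl

lemma bilin_neg_left (L : ℝ) (u v : Coeff) : bilin L (-u) v = -bilin L u v := by
  rw [bilin, advect_neg_left, leray_neg]; rfl

lemma bilin_neg_right (L : ℝ) (u v : Coeff) : bilin L u (-v) = -bilin L u v := by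
  rw [bilin, advect_neg_right, leray_neg]; rfl

/-- With `w = u + g` and `g = p + q`, the nonlinearity splits into four terms containing `q`. -/
lemma bilin_splitting (L : ℝ) {u w p : Coeff} (hu : u ∈ VSpace 1) (hw : w ∈ VSpace 1)
    (hp : p ∈ VSpace 1) :
    bilin L ((w - u) - p) w + bilin L w ((w - u) - p) + bilin L (p - (w - u)) p
        + bilin L (w - u) (p - (w - u))
      = bilin L (w - p) (w - p) - bilin L u u := by
  obtain ⟨q, hq⟩ : ∃ q, q = (w - u) - p := ⟨_, rfl⟩
  have hqV : q ∈ VSpace 1 := hq ▸ VSpace.sub (VSpace.sub hw hu) hp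
  have hw' : w = u + p + q := by rw [hq]; abel
  have e1 : u + p + q - u = p + q := by abel
  have e2 : p - (p + q) = -q := by abel
  have e3 : u + p + q - p = u + q := by abel
  rw [← hq, hw', e1, e2, e3]
  simp only [bilin_neg_left, bilin_neg_right]
  rw [bilin_add_right L hqV (VSpace.add hu hp) hqV, bilin_add_right L hqV hu hp,
    bilin_add_left L (VSpace.add hu hp) hqV hqV, bilin_add_left L hu hp hqV,
    bilin_add_left L hp hqV hqV, bilin_add_left L hu hqV (VSpace.add hu hqV),
    bilin_add_right L hu hu hqV, bilin_add_right L hqV hu hqV]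
  abel

/-! ### Fourier series on the torus -/

instance : IsProbabilityMeasure torusMeasure := by unfold torusMeasure; infer_instance

lemma mFourierCoeff_eq (f : UnitAddTorus (Fin 3) → ℂ) (K : Fin 3 → ℤ) :
    mFourierCoeff f K = ∫ t, mFourier (-K) t * f t ∂torusMeasure := rfl

lemma mFourierCoeff_congr {f g : UnitAddTorus (Fin 3) → ℂ} (h : f =ᵐ[torusMeasure] g)
    (K : Fin 3 → ℤ) : mFourierCoeff f K = mFourierCoeff g K := by
  simp only [mFourierCoeff_eq]
  refine integral_congr_ae ?_
  filter_upwards [h] with t ht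
  rw [ht]

lemma norm_mFourier_apply (K : Fin 3 → ℤ) (t : UnitAddTorus (Fin 3)) : ‖mFourier K t‖ = 1 := by
  simp [mFourier, norm_prod, Circle.norm_coe]

lemma memLp_mFourier_mul {f : UnitAddTorus (Fin 3) → ℂ} {p : ENNReal} (hf : MemLp f p torusMeasure)
    (K : Fin 3 → ℤ) : MemLp (fun t => mFourier K t * f t) p torusMeasure :=
  hf.of_le ((mFourier K).continuous.aestronglyMeasurable.mul hf.1)
    (Eventually.of_forall fun t => by simp [norm_mFourier_apply])

lemma memLp_conj {f : UnitAddTorus (Fin 3) → ℂ} {p : ENNReal} (hf : MemLp f p torusMeasure) :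
    MemLp (fun t => conj (f t)) p torusMeasure :=
  hf.of_le (Complex.continuous_conj.comp_aestronglyMeasurable hf.1)
    (Eventually.of_forall fun t => by simp)

lemma hasSum_conj_mFourierCoeff_mul_Lp (f g : Lp ℂ 2 torusMeasure) :
    HasSum (fun K => conj (mFourierCoeff f K) * mFourierCoeff g K)
      (∫ t, conj (f t) * g t ∂torusMeasure) :=
  UnitAddTorus.hasSum_prod_mFourierCoeff (d := Fin 3) f g

lemma hasSum_mFourier_Lp (f : Lp ℂ 2 torusMeasure) :
    HasSum (fun K => mFourierCoeff f K • ContinuousMap.toLp (E := ℂ) 2 torusMeasure ℂ (mFourier K))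
      f :=
  UnitAddTorus.hasSum_mFourier_series_L2 (d := Fin 3) f

lemma hasSum_conj_mFourierCoeff_mul {f g : UnitAddTorus (Fin 3) → ℂ} (hf : MemLp f 2 torusMeasure)
    (hg : MemLp g 2 torusMeasure) :
    HasSum (fun K => conj (mFourierCoeff f K) * mFourierCoeff g K)
      (∫ t, conj (f t) * g t ∂torusMeasure) := by
  have h := hasSum_conj_mFourierCoeff_mul_Lp (hf.toLp f) (hg.toLp g)
  have h1 : (fun K => conj (mFourierCoeff f K) * mFourierCoeff g K) =
      fun K => conj (mFourierCoeff (hf.toLp f) K) * mFourierCoeff (hg.toLp g) K := by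
    funext K
    rw [mFourierCoeff_congr hf.coeFn_toLp, mFourierCoeff_congr hg.coeFn_toLp]
  rw [h1]
  convert! h using 1
  refine integral_congr_ae ?_
  filter_upwards [hf.coeFn_toLp, hg.coeFn_toLp] with t h1 h2
  rw [h1, h2]

/-- **Riesz-Fischer**. -/
lemma exists_memLp_mFourierCoeff_eq {a : (Fin 3 → ℤ) → ℂ} (ha : Summable fun K => ‖a K‖ ^ 2) :
    ∃ f : UnitAddTorus (Fin 3) → ℂ, MemLp f 2 torusMeasure ∧ ∀ K, mFourierCoeff f K = a K := by
  have hmem : Memℓp a 2 := memℓp_gen (by simpa using ha)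
  let F := (UnitAddTorus.mFourierBasis (d := Fin 3)).repr.symm ⟨a, hmem⟩
  refine ⟨F, Lp.memLp F, fun K => ?_⟩
  rw [← UnitAddTorus.mFourierBasis_repr]
  simp [F]

/-- The Fourier coefficients of a product are the convolution of the Fourier coefficients. -/
lemma hasSum_mFourierCoeff_mul {f g : UnitAddTorus (Fin 3) → ℂ} (hf : MemLp f 2 torusMeasure)
    (hg : MemLp g 2 torusMeasure) (K : Fin 3 → ℤ) :
    HasSum (fun J => mFourierCoeff f J * mFourierCoeff g (K - J))
      (mFourierCoeff (fun t => f t * g t) K) := by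
  have h := hasSum_conj_mFourierCoeff_mul (memLp_mFourier_mul (memLp_conj hg) K) hf
  convert! h using 1
  · funext J
    rw [mul_comm]
    congr 1
    rw [mFourierCoeff_eq, mFourierCoeff_eq, ← integral_conj]
    refine integral_congr_ae (Eventually.of_forall fun t => ?_)
    simp only [map_mul, Complex.conj_conj, ← mul_assoc]
    rw [← UnitAddTorus.mFourier_neg, ← UnitAddTorus.mFourier_neg, ← UnitAddTorus.mFourier_add]
    congr 3
    abel
  · rw [mFourierCoeff_eq]
    refine integral_congr_ae (Eventually.of_forall fun t => ?_)
    simp only [map_mul, Complex.conj_conj]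
    rw [← UnitAddTorus.mFourier_neg]; ring

/-- A square integrable function with finitely many modes is a trigonometric polynomial. -/
lemma ae_eq_sum_mFourier {f : UnitAddTorus (Fin 3) → ℂ} (hf : MemLp f 2 torusMeasure)
    {S : Finset (Fin 3 → ℤ)} (hS : ∀ K ∉ S, mFourierCoeff f K = 0) :
    f =ᵐ[torusMeasure] fun t => ∑ K ∈ S, mFourierCoeff f K * mFourier K t := by
  have h := hasSum_mFourier_Lp (hf.toLp f)
  have h2 := h.unique (hasSum_sum_of_ne_finset_zero (s := S) fun K hK => by
    rw [mFourierCoeff_congr hf.coeFn_toLp, hS K hK, zero_smul])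
  refine hf.coeFn_toLp.symm.trans ?_
  rw [h2]
  refine (Lp.coeFn_finsetSum _ _).trans ?_
  have h3 : ∀ᵐ t ∂torusMeasure, ∀ K ∈ S,
      (mFourierCoeff (hf.toLp f) K •
        ContinuousMap.toLp (E := ℂ) 2 torusMeasure ℂ (mFourier K) : Lp ℂ 2 torusMeasure) t
        = mFourierCoeff f K * mFourier K t := by
    rw [Finset.eventually_all]
    intro K _
    filter_upwards [Lp.coeFn_smul (mFourierCoeff (hf.toLp f) K)
      (ContinuousMap.toLp (E := ℂ) 2 torusMeasure ℂ (mFourier K)),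
      ContinuousMap.coeFn_toLp (𝕜 := ℂ) (p := 2) torusMeasure (mFourier K)] with t h4 h5
    rw [h4, Pi.smul_apply, h5, smul_eq_mul, mFourierCoeff_congr hf.coeFn_toLp]
  filter_upwards [h3] with t ht
  rw [Finset.sum_apply]
  exact Finset.sum_congr rfl ht

/-- Parseval's identity for a triple product whose last factor has finitely many modes. -/
lemma integral_mul_mul_conj_eq {f g h : UnitAddTorus (Fin 3) → ℂ} (hf : MemLp f 2 torusMeasure)
    (hg : MemLp g 2 torusMeasure) (hh : MemLp h 2 torusMeasure)
    {S : Finset (Fin 3 → ℤ)} (hS : ∀ K ∉ S, mFourierCoeff h K = 0) :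
    Integrable (fun t => f t * g t * conj (h t)) torusMeasure ∧
    ∫ t, f t * g t * conj (h t) ∂torusMeasure
      = ∑ K ∈ S, (∑' J, mFourierCoeff f J * mFourierCoeff g (K - J)) * conj (mFourierCoeff h K) := by
  have hfg : Integrable (fun t => f t * g t) torusMeasure := hf.integrable_mul hg
  have hae : (fun t => f t * g t * conj (h t)) =ᵐ[torusMeasure]
      fun t => ∑ K ∈ S, (mFourier (-K) t * (f t * g t)) * conj (mFourierCoeff h K) := by
    filter_upwards [ae_eq_sum_mFourier hh hS] with t ht
    conv_lhs => rw [ht]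
    simp only [map_sum, map_mul, Finset.mul_sum]
    refine Finset.sum_congr rfl fun K _ => ?_
    rw [UnitAddTorus.mFourier_neg]; ring
  have hint : ∀ K ∈ S, Integrable
      (fun t => (mFourier (-K) t * (f t * g t)) * conj (mFourierCoeff h K)) torusMeasure :=
    fun K _ => ((memLp_one_iff_integrable.1 (memLp_mFourier_mul
      (memLp_one_iff_integrable.2 hfg) (-K))).mul_const _)
  refine ⟨(integrable_congr hae).2 (integrable_finsetSum S hint), ?_⟩
  rw [integral_congr_ae hae, integral_finsetSum S hint]
  refine Finset.sum_congr rfl fun K _ => ?_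
  rw [integral_mul_const, (hasSum_mFourierCoeff_mul hf hg K).tsum_eq,
    mFourierCoeff_eq (fun t => f t * g t)]

/-- A square summable, conjugation symmetric family is the family of Fourier coefficients of a real
function. -/
lemma exists_real_memLp {a : (Fin 3 → ℤ) → ℂ} (ha : Summable fun K => ‖a K‖ ^ 2)
    (hsymm : ∀ K, a (-K) = conj (a K)) :
    ∃ f : UnitAddTorus (Fin 3) → ℝ, MemLp f 2 torusMeasure ∧
      ∀ K, mFourierCoeff (fun t => (f t : ℂ)) K = a K := by
  obtain ⟨F, hF, hFa⟩ := exists_memLp_mFourierCoeff_eq ha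
  refine ⟨fun t => (F t).re, hF.re, fun K => ?_⟩
  have e : ∀ t, mFourier (-K) t * ((F t).re : ℂ)
      = (mFourier (-K) t * F t + conj (mFourier (- -K) t * F t)) / 2 := fun t => by
    rw [map_mul, ← UnitAddTorus.mFourier_neg, neg_neg, Complex.re_eq_add_conj]; ring
  have hi : ∀ J, Integrable (fun t => mFourier J t * F t) torusMeasure := fun J =>
    (memLp_mFourier_mul hF J).integrable (by norm_num)
  have hi' : Integrable (fun t => conj (mFourier (- -K) t * F t)) torusMeasure :=
    memLp_one_iff_integrable.1 (memLp_conj (memLp_one_iff_integrable.2 (hi _)))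
  rw [mFourierCoeff_eq]
  simp only [e]
  rw [integral_div, integral_add (hi _) hi', integral_conj, ← mFourierCoeff_eq, ← mFourierCoeff_eq,
    hFa, hFa, hsymm, Complex.conj_conj]
  ring

/-- Vector valued version of `exists_real_memLp`, with Parseval's identity. -/
lemma exists_real_memLp_vector {ι : Type*} [Fintype ι] {a : (Fin 3 → ℤ) → EuclideanSpace ℂ ι}
    (ha : Summable fun K => ‖a K‖ ^ 2) (hsymm : ∀ K j, a (-K) j = conj (a K j)) :
    ∃ G : UnitAddTorus (Fin 3) → EuclideanSpace ℝ ι, MemLp G 2 torusMeasure ∧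
      (∀ K j, mFourierCoeff (fun t => ((G t j : ℝ) : ℂ)) K = a K j) ∧
      (eLpNorm G 2 torusMeasure).toReal ^ 2 = ∑' K, ‖a K‖ ^ 2 := by
  have hle : ∀ K j, ‖a K j‖ ^ 2 ≤ ‖a K‖ ^ 2 := fun K j =>
    pow_le_pow_left₀ (norm_nonneg _) (PiLp.norm_apply_le (a K) j) 2
  have haj : ∀ j, Summable fun K => ‖a K j‖ ^ 2 := fun j =>
    Summable.of_nonneg_of_le (fun K => sq_nonneg _) (fun K => hle K j) ha
  choose f hf hfa using fun j => exists_real_memLp (haj j) (fun K => hsymm K j)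
  have hG : MemLp (fun t => WithLp.toLp 2 fun j => f j t : _ → EuclideanSpace ℝ ι) 2
      torusMeasure := (memLp_piLp_iff (p := 2) (q := 2)).2 hf
  refine ⟨_, hG, fun K j => hfa j K, ?_⟩
  have hP : ∀ j, HasSum (fun K => ‖a K j‖ ^ 2) (∫ t, f j t ^ 2 ∂torusMeasure) := fun j => by
    have hc : MemLp (fun t => ((f j t : ℝ) : ℂ)) 2 torusMeasure := (hf j).ofReal
    have := hasSum_conj_mFourierCoeff_mul hc hc
    simp only [hfa, Complex.conj_mul', Complex.conj_ofReal, ← Complex.ofReal_mul] at this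
    rw [integral_complex_ofReal] at this
    have h2 := Complex.hasSum_re this
    simp only [← Complex.ofReal_pow, Complex.ofReal_re, ← sq] at h2
    exact h2
  have h1 : ∑' K, ‖a K‖ ^ 2 = ∑ j, ∫ t, f j t ^ 2 ∂torusMeasure := by
    simp only [EuclideanSpace.norm_sq_eq]
    rw [Summable.tsum_finsetSum fun j _ => haj j]
    exact Finset.sum_congr rfl fun j _ => (hP j).tsum_eq
  rw [h1, ← integral_finsetSum _ fun j _ => (hf j).integrable_sq, 
    hG.eLpNorm_eq_integral_rpow_norm (by norm_num) (by norm_num),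
    ENNReal.toReal_ofReal (by positivity)]
  simp only [ENNReal.toReal_ofNat, Real.rpow_two, ← one_div, EuclideanSpace.norm_sq_eq,
    Real.norm_eq_abs, sq_abs]
  rw [← Real.sqrt_eq_rpow, Real.sq_sqrt (integral_nonneg fun t =>
    Finset.sum_nonneg fun _ _ => sq_nonneg _)]

/-! ### Trilinear estimates -/

/-- The Fourier coefficients `(2πi/L) K_i û_K,j` of the gradient `∂_i u_j`. -/
def gradCoeff (L : ℝ) (u : Coeff) (K : Fin 3 → ℤ) : EuclideanSpace ℂ (Fin 3 × Fin 3) :=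
  WithLp.toLp 2 fun p => 2 * Real.pi * Complex.I / L * (K p.1 : ℂ) * u K p.2

lemma gradCoeff_apply (L : ℝ) (u : Coeff) (K : Fin 3 → ℤ) (i j : Fin 3) :
    gradCoeff L u K (i, j) = 2 * Real.pi * Complex.I / L * (K i : ℂ) * u K j := rfl

lemma norm_gradCoeff_sq (L : ℝ) (u : Coeff) (K : Fin 3 → ℤ) :
    ‖gradCoeff L u K‖ ^ 2 = lam L K * ‖u K‖ ^ 2 := by
  rw [EuclideanSpace.norm_sq_eq, EuclideanSpace.norm_sq_eq, Fintype.sum_prod_type]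
  simp only [gradCoeff_apply, norm_mul, mul_pow, ← Finset.mul_sum, ← Finset.sum_mul]
  congr 1
  simp [lam, normSq, div_pow, mul_pow]
  ring

lemma gradCoeff_neg (L : ℝ) {s : ℕ} {u : Coeff} (hu : u ∈ VSpace s) (K : Fin 3 → ℤ)
    (p : Fin 3 × Fin 3) : gradCoeff L u (-K) p = conj (gradCoeff L u K p) := by
  obtain ⟨i, j⟩ := p
  simp only [gradCoeff_apply, hu.2.1 K j, map_mul, map_div₀, Complex.conj_I, Complex.conj_ofReal,
    Pi.neg_apply, Int.cast_neg, map_intCast, map_ofNat]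
  ring

lemma exists_field {u : Coeff} (hu : u ∈ VSpace 1) :
    ∃ G : UnitAddTorus (Fin 3) → EuclideanSpace ℝ (Fin 3), MemLp G 2 torusMeasure ∧
      ∀ K j, mFourierCoeff (fun t => ((G t j : ℝ) : ℂ)) K = u K j := by
  obtain ⟨G, h1, h2, _⟩ := exists_real_memLp_vector (VSpace.summable_norm_sq hu) hu.2.1
  exact ⟨G, h1, h2⟩

lemma exists_gradient {L : ℝ} (hL : 0 < L) {u : Coeff} (hu : u ∈ VSpace 1) :
    ∃ D : UnitAddTorus (Fin 3) → EuclideanSpace ℝ (Fin 3 × Fin 3), MemLp D 2 torusMeasure ∧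
      (∀ K p, mFourierCoeff (fun t => ((D t p : ℝ) : ℂ)) K = gradCoeff L u K p) ∧
      ENNReal.ofReal (L ^ (3 / 2 : ℝ)) * eLpNorm D 2 torusMeasure
        = ENNReal.ofReal (sNorm L 1 u) := by
  have hs := VSpace.summable_lam L hu
  simp only [pow_one, ← norm_gradCoeff_sq] at hs
  obtain ⟨D, h1, h2, h3⟩ := exists_real_memLp_vector hs (gradCoeff_neg L hu)
  refine ⟨D, h1, h2, ?_⟩
  rw [← ENNReal.ofReal_toReal h1.eLpNorm_ne_top, ← ENNReal.ofReal_mul (by positivity)]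
  congr 1
  have h4 : (L ^ (3 / 2 : ℝ) * (eLpNorm D 2 torusMeasure).toReal) ^ 2 = sNorm L 1 u ^ 2 := by
    rw [mul_pow, h3, sNorm_sq hL, ← Real.rpow_natCast, ← Real.rpow_mul hL.le]
    simp only [norm_gradCoeff_sq, pow_one]
    congr 1
    norm_num
  exact (sq_eq_sq₀ (by positivity) (sNorm_nonneg _ _ _)).1 h4

lemma advect_apply_eq_sum {L : ℝ} {u v : Coeff} (hu : u ∈ VSpace 1) (hv : v ∈ VSpace 1)
    (K : Fin 3 → ℤ) (j : Fin 3)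
    (hc : ∀ i, Summable fun J => u J i * gradCoeff L v (K - J) (i, j)) :
    advect L u v K j = ∑ i, ∑' J, u J i * gradCoeff L v (K - J) (i, j) := by
  have h1 := (summable_advect L hu hv K).hasSum.mapL (EuclideanSpace.proj (𝕜 := ℂ) j)
  refine h1.unique ?_
  convert! hasSum_sum (s := Finset.univ) fun i _ => (hc i).hasSum using 2 with J
  change ((_ : ℂ) • v (K - J)) j = _
  simp only [PiLp.smul_apply, dotK, smul_eq_mul, gradCoeff_apply,
    Finset.mul_sum, Finset.sum_mul, Pi.sub_apply, Int.cast_sub]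
  exact Finset.sum_congr rfl fun i _ => by ring

lemma advect_apply_eq_sum_of_div_free {L : ℝ} {u v : Coeff} (hu : u ∈ VSpace 1)
    (hv : v ∈ VSpace 1) (K : Fin 3 → ℤ) (j : Fin 3)
    (hc : ∀ i, Summable fun J => u J i * v (K - J) j) :
    advect L u v K j
      = ∑ i, 2 * Real.pi * Complex.I / L * (K i : ℂ) * ∑' J, u J i * v (K - J) j := by
  have h1 := (summable_advect L hu hv K).hasSum.mapL (EuclideanSpace.proj (𝕜 := ℂ) j)
  refine h1.unique ?_
  convert! hasSum_sum (s := Finset.univ) fun i _ => ((hc i).hasSum.mul_left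
    (2 * Real.pi * Complex.I / L * (K i : ℂ))) using 2 with J
  have h2 : dotK (u J) (K - J) = dotK (u J) K := by
    have h3 := hu.2.2.1 J
    simp only [dotK, Pi.sub_apply, Int.cast_sub, mul_sub, Finset.sum_sub_distrib] at h3 ⊢
    rw [h3, sub_zero]
  rw [h2]
  change ((_ : ℂ) • v (K - J)) j = _
  simp only [PiLp.smul_apply, dotK, smul_eq_mul,
    Finset.mul_sum, Finset.sum_mul]
  exact Finset.sum_congr rfl fun i _ => by ring

section Holder

variable {A R : UnitAddTorus (Fin 3) → EuclideanSpace ℝ (Fin 3)}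
  {D : UnitAddTorus (Fin 3) → EuclideanSpace ℝ (Fin 3 × Fin 3)}

lemma abs_sum_mul_le (a r : EuclideanSpace ℝ (Fin 3)) (d : EuclideanSpace ℝ (Fin 3 × Fin 3)) :
    |∑ j, ∑ i, a i * d (i, j) * r j| ≤ ‖a‖ * ‖r‖ * ‖d‖ := by
  let x : EuclideanSpace ℝ (Fin 3 × Fin 3) := WithLp.toLp 2 fun p => a p.1 * r p.2
  have hx : ‖x‖ = ‖a‖ * ‖r‖ := by
    refine (sq_eq_sq₀ (norm_nonneg _) (by positivity)).1 ?_
    rw [mul_pow, EuclideanSpace.norm_sq_eq, EuclideanSpace.norm_sq_eq, EuclideanSpace.norm_sq_eq,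
      Fintype.sum_prod_type, Finset.sum_mul_sum]
    simp [x, mul_pow]
  have h : ∑ j, ∑ i, a i * d (i, j) * r j = inner ℝ x d := by
    rw [Finset.sum_comm]
    simp only [PiLp.inner_apply, Fintype.sum_prod_type, x]
    exact Finset.sum_congr rfl fun i _ => Finset.sum_congr rfl fun j _ => by simp; ring
  rw [h, ← hx]
  exact abs_real_inner_le_norm _ _

lemma enorm_integral_sum_mul_le {p q : ENNReal} [ENNReal.HolderTriple p q 2]
    (hA : AEStronglyMeasurable A torusMeasure) (hR : AEStronglyMeasurable R torusMeasure)
    (hD : AEStronglyMeasurable D torusMeasure) :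
    ‖∫ t, ∑ j, ∑ i, A t i * D t (i, j) * R t j ∂torusMeasure‖ₑ
      ≤ eLpNorm A p torusMeasure * eLpNorm R q torusMeasure * eLpNorm D 2 torusMeasure := by
  calc _ ≤ eLpNorm (fun t => ∑ j, ∑ i, A t i * D t (i, j) * R t j) 1 torusMeasure := by
        rw [eLpNorm_one_eq_lintegral_enorm]; exact enorm_integral_le_lintegral_enorm _
    _ ≤ eLpNorm (((fun t => ‖A t‖) • fun t => ‖R t‖) • fun t => ‖D t‖) 1 torusMeasure := by
        refine eLpNorm_mono fun t => ?_
        simpa [abs_mul] using abs_sum_mul_le (A t) (R t) (D t)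
    _ ≤ eLpNorm ((fun t => ‖A t‖) • fun t => ‖R t‖) 2 torusMeasure
          * eLpNorm (fun t => ‖D t‖) 2 torusMeasure :=
        eLpNorm_smul_le_mul_eLpNorm hD.norm (hA.norm.smul hR.norm)
    _ ≤ _ := by
        rw [eLpNorm_norm D]
        gcongr
        rw [← eLpNorm_norm A, ← eLpNorm_norm R]
        exact eLpNorm_smul_le_mul_eLpNorm hR.norm hA.norm

end Holder

lemma holderTriple_three_six : ENNReal.HolderTriple 3 6 2 := by
  refine ⟨?_⟩
  rw [← ENNReal.toReal_eq_toReal_iff' (by simp) (by simp), ENNReal.toReal_add (by simp) (by simp)]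
  norm_num

section Trilinear

variable {L c : ℝ} {u v r : Coeff} {S : Finset (Fin 3 → ℤ)}

lemma IsGagliardoNirenbergConst.bounds (hc : IsGagliardoNirenbergConst L c) (hu : u ∈ VSpace 1)
    {G : UnitAddTorus (Fin 3) → EuclideanSpace ℝ (Fin 3)} (hG : MemLp G 2 torusMeasure)
    (hGu : ∀ K j, mFourierCoeff (fun t => ((G t j : ℝ) : ℂ)) K = u K j) :
    ENNReal.ofReal L * eLpNorm G 3 torusMeasure
        ≤ ENNReal.ofReal (|c| * (sNorm L 0 u ^ (1 / 2 : ℝ) * sNorm L 1 u ^ (1 / 2 : ℝ))) ∧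
      ENNReal.ofReal (L ^ (1 / 2 : ℝ)) * eLpNorm G 6 torusMeasure
        ≤ ENNReal.ofReal (|c| * sNorm L 1 u) := by
  have hGu' : fieldCoeff G = u := by
    funext K; ext j; exact hGu K j
  obtain ⟨h3, -, h6⟩ := hc G hG (hGu' ▸ hu)
  rw [hGu'] at h3 h6
  have e3 : L ^ ((3 : ℝ) / (3 : ℕ)) = L := by norm_num
  have e6 : (3 : ℝ) / (6 : ℕ) = 1 / 2 := by norm_num
  unfold boxLpNorm at h3 h6
  rw [e3] at h3
  rw [e6] at h6
  have hX := Real.rpow_nonneg (sNorm_nonneg L 0 u) (1 / 2)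
  have hY := Real.rpow_nonneg (sNorm_nonneg L 1 u) (1 / 2)
  refine ⟨le_trans (by exact_mod_cast h3) (ENNReal.ofReal_le_ofReal ?_),
    le_trans (by exact_mod_cast h6) (ENNReal.ofReal_le_ofReal ?_)⟩
  · rw [mul_assoc]
    exact mul_le_mul_of_nonneg_right (le_abs_self c) (mul_nonneg hX hY)
  · exact mul_le_mul_of_nonneg_right (le_abs_self c) (sNorm_nonneg _ _ _)

lemma abs_le_of_holder_bounds (hL : 0 < L) {I a₁ a₂ a₃ : ℝ} {x y z : ENNReal} (h₁ : 0 ≤ a₁)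
    (h₂ : 0 ≤ a₂) (h₃ : 0 ≤ a₃) (hI : ‖I‖ₑ ≤ x * y * z)
    (hx : ENNReal.ofReal L * x ≤ ENNReal.ofReal a₁)
    (hy : ENNReal.ofReal (L ^ (1 / 2 : ℝ)) * y ≤ ENNReal.ofReal a₂)
    (hz : ENNReal.ofReal (L ^ (3 / 2 : ℝ)) * z ≤ ENNReal.ofReal a₃) :
    |L ^ 3 * I| ≤ a₁ * a₂ * a₃ := by
  have hLp : L ^ 3 = L * L ^ (1 / 2 : ℝ) * L ^ (3 / 2 : ℝ) := by
    rw [← Real.rpow_natCast]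
    nth_rewrite 2 [← Real.rpow_one L]
    rw [← Real.rpow_add hL, ← Real.rpow_add hL]
    norm_num
  rw [← ENNReal.ofReal_le_ofReal_iff (by positivity), abs_mul, abs_of_pos (pow_pos hL 3),
    ENNReal.ofReal_mul (by positivity), ← Real.norm_eq_abs, ofReal_norm]
  calc ENNReal.ofReal (L ^ 3) * ‖I‖ₑ ≤ ENNReal.ofReal (L ^ 3) * (x * y * z) := by gcongr
    _ = (ENNReal.ofReal L * x) * (ENNReal.ofReal (L ^ (1 / 2 : ℝ)) * y)
          * (ENNReal.ofReal (L ^ (3 / 2 : ℝ)) * z) := by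
        rw [hLp, ENNReal.ofReal_mul (by positivity), ENNReal.ofReal_mul hL.le]; ring
    _ ≤ ENNReal.ofReal a₁ * ENNReal.ofReal a₂ * ENNReal.ofReal a₃ := by gcongr
    _ = _ := by rw [ENNReal.ofReal_mul (by positivity), ENNReal.ofReal_mul h₁]

lemma sInner_bilin_eq (hr : r ∈ VSpace 1) (hS : ∀ K ∉ S, r K = 0) :
    sInner L 0 (bilin L u v) r = L ^ 3 * (∑ K ∈ S, ∑ j, advect L u v K j * conj (r K j)).re := by
  rw [sInner_eq_sum hS, Complex.re_sum]
  congr 1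
  refine Finset.sum_congr rfl fun K _ => ?_
  rw [bilin, inner_leray hr.1 hr.2.2.1, pow_zero, one_mul]
  simp [PiLp.inner_apply]

/-- `‖a‖_{L³} ‖∇b‖ ‖d‖_{L⁶}` bounds the trilinear form. -/
lemma abs_sInner_bilin_le_left (hL : 0 < L) (hc : IsGagliardoNirenbergConst L c)
    (hu : u ∈ VSpace 1) (hv : v ∈ VSpace 1) (hr : r ∈ VSpace 1) (hS : ∀ K ∉ S, r K = 0) :
    |sInner L 0 (bilin L u v) r|
      ≤ c ^ 2 * (sNorm L 0 u ^ (1 / 2 : ℝ) * sNorm L 1 u ^ (1 / 2 : ℝ)) * sNorm L 1 v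
        * sNorm L 1 r := by
  obtain ⟨A, hA, hAu⟩ := exists_field hu
  obtain ⟨R, hR, hRr⟩ := exists_field hr
  obtain ⟨D, hD, hDv, hDn⟩ := exists_gradient hL hv
  have hA' : ∀ i, MemLp (fun t => ((A t i : ℝ) : ℂ)) 2 torusMeasure :=
    fun i => (hA.eval_piLp i).ofReal
  have hR' : ∀ i, MemLp (fun t => ((R t i : ℝ) : ℂ)) 2 torusMeasure :=
    fun i => (hR.eval_piLp i).ofReal
  have hD' : ∀ p, MemLp (fun t => ((D t p : ℝ) : ℂ)) 2 torusMeasure :=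
    fun p => (hD.eval_piLp p).ofReal
  have key := fun i j => integral_mul_mul_conj_eq (hA' i) (hD' (i, j)) (hR' j) (S := S)
    fun K hK => by rw [hRr, hS K hK]; rfl
  have hsum : ∀ K j i, Summable fun J => u J i * gradCoeff L v (K - J) (i, j) := fun K j i => by
    simpa only [hAu, hDv] using (hasSum_mFourierCoeff_mul (hA' i) (hD' (i, j)) K).summable
  simp only [hAu, hDv, hRr, Complex.conj_ofReal] at key
  have heq : ∑ K ∈ S, ∑ j, advect L u v K j * conj (r K j)
      = ((∫ t, ∑ j, ∑ i, A t i * D t (i, j) * R t j ∂torusMeasure : ℝ) : ℂ) := by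
    rw [← integral_complex_ofReal]
    push_cast
    rw [integral_finsetSum _ fun j _ => integrable_finsetSum _ fun i _ => (key i j).1,
      Finset.sum_comm]
    refine Finset.sum_congr rfl fun j _ => ?_
    rw [integral_finsetSum _ fun i _ => (key i j).1]
    simp only [(key _ j).2, advect_apply_eq_sum hu hv _ j (hsum _ j), Finset.sum_mul]
    exact Finset.sum_comm
  rw [sInner_bilin_eq hr hS, heq, Complex.ofReal_re]
  have := holderTriple_three_six
  have h := abs_le_of_holder_bounds hL
    (mul_nonneg (abs_nonneg c) (mul_nonneg (Real.rpow_nonneg (sNorm_nonneg L 0 u) _)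
      (Real.rpow_nonneg (sNorm_nonneg L 1 u) _)))
    (mul_nonneg (abs_nonneg c) (sNorm_nonneg L 1 r)) (sNorm_nonneg L 1 v)
    (enorm_integral_sum_mul_le (p := 3) (q := 6) hA.1 hR.1 hD.1) (hc.bounds hu hA hAu).1
    (hc.bounds hr hR hRr).2 hDn.le
  refine h.trans (le_of_eq ?_)
  rw [← sq_abs c]; ring

/-- After an integration by parts, `‖a‖_{L⁶} ‖b‖_{L³} ‖∇d‖` bounds the trilinear form. -/
lemma abs_sInner_bilin_le_right (hL : 0 < L) (hc : IsGagliardoNirenbergConst L c)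
    (hu : u ∈ VSpace 1) (hv : v ∈ VSpace 1) (hr : r ∈ VSpace 1) (hS : ∀ K ∉ S, r K = 0) :
    |sInner L 0 (bilin L u v) r|
      ≤ c ^ 2 * (sNorm L 0 v ^ (1 / 2 : ℝ) * sNorm L 1 v ^ (1 / 2 : ℝ)) * sNorm L 1 u
        * sNorm L 1 r := by
  obtain ⟨A, hA, hAu⟩ := exists_field hu
  obtain ⟨B, hB, hBv⟩ := exists_field hv
  obtain ⟨D, hD, hDr, hDn⟩ := exists_gradient hL hr
  have hA' : ∀ i, MemLp (fun t => ((A t i : ℝ) : ℂ)) 2 torusMeasure :=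
    fun i => (hA.eval_piLp i).ofReal
  have hB' : ∀ i, MemLp (fun t => ((B t i : ℝ) : ℂ)) 2 torusMeasure :=
    fun i => (hB.eval_piLp i).ofReal
  have hD' : ∀ p, MemLp (fun t => ((D t p : ℝ) : ℂ)) 2 torusMeasure :=
    fun p => (hD.eval_piLp p).ofReal
  have key := fun i j => integral_mul_mul_conj_eq (hA' i) (hB' j) (hD' (i, j)) (S := S)
    fun K hK => by rw [hDr, gradCoeff_apply, hS K hK]; simp
  have hsum : ∀ K j i, Summable fun J => u J i * v (K - J) j := fun K j i => by
    simpa only [hAu, hBv] using (hasSum_mFourierCoeff_mul (hA' i) (hB' j) K).summable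
  simp only [hAu, hBv, hDr, Complex.conj_ofReal] at key
  have heq : ∑ K ∈ S, ∑ j, advect L u v K j * conj (r K j)
      = -((∫ t, ∑ j, ∑ i, A t i * D t (i, j) * B t j ∂torusMeasure : ℝ) : ℂ) := by
    rw [← integral_complex_ofReal]
    push_cast
    have key1 : ∀ i j, Integrable (fun t => (A t i : ℂ) * D t (i, j) * B t j) torusMeasure :=
      fun i j => (key i j).1.congr (Eventually.of_forall fun t => by simp only; ring)
    have key2 : ∀ i j, ∫ t, (A t i : ℂ) * D t (i, j) * B t j ∂torusMeasure
        = ∑ K ∈ S, (∑' J, u J i * v (K - J) j) * conj (gradCoeff L r K (i, j)) := fun i j => by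
      rw [← (key i j).2]
      exact integral_congr_ae (Eventually.of_forall fun t => by simp only; ring)
    rw [integral_finsetSum _ fun j _ => integrable_finsetSum _ fun i _ => key1 i j,
      Finset.sum_comm, ← Finset.sum_neg_distrib]
    refine Finset.sum_congr rfl fun j _ => ?_
    rw [integral_finsetSum _ fun i _ => key1 i j]
    simp only [key2 _ j, advect_apply_eq_sum_of_div_free hu hv _ j (hsum _ j), Finset.sum_mul]
    rw [Finset.sum_comm, ← Finset.sum_neg_distrib]
    refine Finset.sum_congr rfl fun i _ => ?_
    rw [← Finset.sum_neg_distrib]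
    refine Finset.sum_congr rfl fun K _ => ?_
    simp only [gradCoeff_apply, map_mul, map_div₀, Complex.conj_I, Complex.conj_ofReal,
      map_intCast, map_ofNat]
    ring
  rw [sInner_bilin_eq hr hS, heq, Complex.neg_re, Complex.ofReal_re, mul_neg, abs_neg]
  have := holderTriple_three_six
  have h := abs_le_of_holder_bounds hL
    (mul_nonneg (abs_nonneg c) (mul_nonneg (Real.rpow_nonneg (sNorm_nonneg L 0 v) _)
      (Real.rpow_nonneg (sNorm_nonneg L 1 v) _)))
    (mul_nonneg (abs_nonneg c) (sNorm_nonneg L 1 u)) (sNorm_nonneg L 1 r)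
    ((enorm_integral_sum_mul_le (p := 6) (q := 3) hA.1 hB.1 hD.1).trans_eq
      (by rw [mul_comm (eLpNorm A 6 torusMeasure)])) (hc.bounds hv hB hBv).1
    (hc.bounds hu hA hAu).2 hDn.le
  refine h.trans (le_of_eq ?_)
  rw [← sq_abs c]; ring

end Trilinear

/-! ### Regularity in time -/

section Regular

variable {L a b : ℝ} {u : ℝ → Coeff}

lemma IsRegular.continuousOn_mode (h : IsRegular L a b u) (hab : a ≤ b) (K : Fin 3 → ℤ) :
    ContinuousOn (fun t => u t K) (Set.Icc a b) := by
  have h1 : ContinuousOn (fun t => u a K + ∫ s in a..t, timeDeriv u s K) (Set.Icc a b) := by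
    refine continuousOn_const.add ?_
    have := intervalIntegral.continuousOn_primitive_interval' (h.deriv_int K) Set.left_mem_uIcc
    rwa [Set.uIcc_of_le hab] at this
  exact h1.congr fun t ht => h.ftc K t ht

lemma IsRegular.ae_hasDerivAt (h : IsRegular L a b u) (hab : a ≤ b) :
    ∀ᵐ t ∂volume.restrict (Set.Icc a b), ∀ K,
      HasDerivAt (fun s => u s K) (timeDeriv u t K) t := by
  refine ae_all_iff.2 fun K => ?_
  rw [← restrict_Ioo_eq_restrict_Icc, ae_restrict_iff' measurableSet_Ioo]
  filter_upwards [(h.deriv_int K).ae_hasDerivAt_integral] with t ht hmem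
  rw [Set.uIcc_of_le hab] at ht
  have h1 := (ht (Set.Ioo_subset_Icc_self hmem) a (Set.left_mem_Icc.2 hab)).const_add (u a K)
  refine h1.congr_of_eventuallyEq ?_
  filter_upwards [Ioo_mem_nhds hmem.1 hmem.2] with s hs
  exact h.ftc K s (Set.Ioo_subset_Icc_self hs)

lemma IsRegular.continuousOn_sNorm (hL : 0 < L) (h : IsRegular L a b u) :
    ContinuousOn (fun t => sNorm L 1 (u t)) (Set.Icc a b) := by
  intro t ht
  rw [ContinuousWithinAt, tendsto_iff_dist_tendsto_zero]
  refine squeeze_zero' (Eventually.of_forall fun _ => dist_nonneg) ?_ (h.cont_V t ht)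
  filter_upwards [self_mem_nhdsWithin] with s hs
  exact abs_sNorm_sub_sNorm_le hL (h.mem_V s hs) (h.mem_V t ht)

end Regular

/-! ### Measurability of the modes -/

/-- Every mode of `x` is almost everywhere strongly measurable. -/
def ModeMeasurable (μ : Measure ℝ) (x : ℝ → Coeff) : Prop :=
  ∀ K, AEStronglyMeasurable (fun t => x t K) μ

namespace ModeMeasurable

variable {μ : Measure ℝ} {x y : ℝ → Coeff}

lemma sub (hx : ModeMeasurable μ x) (hy : ModeMeasurable μ y) :
    ModeMeasurable μ fun t => x t - y t := fun K => (hx K).sub (hy K)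

lemma proj (hx : ModeMeasurable μ x) (N : ℕ) : ModeMeasurable μ fun t => proj N (x t) := by
  intro K
  simp only [Bardina.proj]
  split_ifs
  · exact hx K
  · exact aestronglyMeasurable_const

lemma bilin (hx : ModeMeasurable μ x) (hy : ModeMeasurable μ y)
    (hxV : ∀ᵐ t ∂μ, x t ∈ VSpace 1) (hyV : ∀ᵐ t ∂μ, y t ∈ VSpace 1) (L : ℝ) :
    ModeMeasurable μ fun t => bilin L (x t) (y t) := by
  have hadv : ModeMeasurable μ fun t => advect L (x t) (y t) := by
    intro K
    refine aestronglyMeasurable_of_tendsto_ae (u := (atTop : Filter (Finset (Fin 3 → ℤ))))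
      (f := fun S t => ∑ J ∈ S,
        (2 * Real.pi * Complex.I / L * dotK (x t J) (K - J)) • y t (K - J)) (fun S => ?_) ?_
    · refine Finset.aestronglyMeasurable_fun_sum S fun J _ => ?_
      simp only [dotK_eq_inner]
      exact ((aestronglyMeasurable_const.inner (𝕜 := ℂ) (hx J)).const_mul _).smul (hy (K - J))
    · filter_upwards [hxV, hyV] with t h1 h2
      exact (summable_advect L h1 h2 K).hasSum
  intro K
  simp only [Bardina.bilin, leray]
  split_ifs
  · exact aestronglyMeasurable_const
  · simp only [dotK_eq_inner, div_eq_mul_inv]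
    exact (hadv K).sub (((aestronglyMeasurable_const.inner (hadv K)).mul_const _).smul_const _)

lemma sInner (hx : ModeMeasurable μ x) (hy : ModeMeasurable μ y) {S : Finset (Fin 3 → ℤ)}
    (hS : ∀ t, ∀ K ∉ S, y t K = 0) (L : ℝ) (s : ℕ) :
    AEStronglyMeasurable (fun t => sInner L s (x t) (y t)) μ := by
  simp only [fun t => sInner_eq_sum (hS t) L s (x t)]
  refine (Finset.aestronglyMeasurable_fun_sum S fun K _ => ?_).const_mul _
  exact (Complex.continuous_re.comp_aestronglyMeasurable ((hy K).inner (hx K))).const_mul _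

end ModeMeasurable

lemma IsRegular.modeMeasurable {L a b : ℝ} {u : ℝ → Coeff} (h : IsRegular L a b u)
    (hab : a ≤ b) : ModeMeasurable (volume.restrict (Set.Icc a b)) u := fun K =>
  (h.continuousOn_mode hab K).aestronglyMeasurable measurableSet_Icc

lemma IsRegular.modeMeasurable_timeDeriv {L a b : ℝ} {u : ℝ → Coeff} (h : IsRegular L a b u) :
    ModeMeasurable (volume.restrict (Set.Icc a b)) (timeDeriv u) := fun K => by
  rw [← restrict_Ioc_eq_restrict_Icc]
  exact (h.deriv_int K).aestronglyMeasurable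

/-! ### The residual -/

section Resid

variable {L ν : ℝ} {N : ℕ} {u : ℝ → Coeff}

lemma resid_eq_zero_of_notMem {K : Fin 3 → ℤ} (hK : K ∉ lowModes N) (t : ℝ) :
    resid L ν N u t K = 0 := proj_eq_zero_of_notMem hK _

lemma proj_apply_of_resid_ne_zero {t : ℝ} {K : Fin 3 → ℤ} (hK : resid L ν N u t K ≠ 0)
    (X : Coeff) : proj N X K = X K := by
  simp only [resid, proj] at hK ⊢
  split_ifs with h
  · rfl
  · exact absurd (if_neg h) hK

lemma stokes_mem (L : ℝ) {x : Coeff} (hx : x ∈ VSpace 2) : stokes L x ∈ VSpace 0 := by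
  refine ⟨by simp [stokes, hx.1], fun K j => ?_, fun K => ?_, ?_⟩
  · simp [stokes, lam_eq, normSq_neg, hx.2.1 K j]
  · simp [stokes, dotK_real_smul, hx.2.2.1 K]
  · refine (VSpace.summable_lam L hx).congr fun K => ?_
    simp [stokes, norm_smul, mul_pow]

lemma resid_mem {t : ℝ} (h : timeDeriv u t ∈ VSpace 0) (h' : u t ∈ VSpace 2) :
    resid L ν N u t ∈ VSpace 1 :=
  VSpace.of_finite_support (S := lowModes N)
    (VSpace.proj N (VSpace.add h (VSpace.real_smul ν (stokes_mem L h'))))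
    (fun _ hK => proj_eq_zero_of_notMem hK _) 1

lemma IsRegular.ae_resid_mem {a b : ℝ} (h : IsRegular L a b u) :
    ∀ᵐ t ∂volume.restrict (Set.Icc a b), resid L ν N u t ∈ VSpace 1 := by
  filter_upwards [h.deriv_mem_H, h.mem_DA] with t h1 h2
  exact resid_mem h1 h2

lemma IsRegular.modeMeasurable_resid {a b : ℝ} (h : IsRegular L a b u) (hab : a ≤ b) :
    ModeMeasurable (volume.restrict (Set.Icc a b)) (resid L ν N u) := by
  refine ModeMeasurable.proj (x := fun t => timeDeriv u t + ν • stokes L (u t)) (fun K => ?_) N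
  exact (h.modeMeasurable_timeDeriv K).add
    (((h.modeMeasurable hab K).const_smul (lam L K)).const_smul ν)

end Resid

/-! ### The balance identity -/

lemma re_inner_real_smul (x y : EuclideanSpace ℂ (Fin 3)) (c : ℝ) :
    (inner ℂ x (c • y)).re = c * (inner ℂ x y).re := by
  rw [← Complex.coe_smul, inner_smul_right, Complex.re_ofReal_mul]

lemma mode_balance {E : Type*} [AddCommGroup E] [Module ℝ E] {l ν α β η : ℝ}
    {ut wt U W BU BW B F : E}
    (hu : (ut + α ^ 2 • l • ut) + ν • l • (U + α ^ 2 • l • U) + BU = F)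
    (hw : (wt + β ^ 2 • l • wt) + ν • l • (W + β ^ 2 • l • W) + BW
      = F - η • ((W - U) + β ^ 2 • l • (W - U))) :
    (wt - ut) + (β ^ 2 * l) • (wt - ut) + (ν * l) • (W - U) + (ν * β ^ 2 * l) • l • (W - U)
        + (BW - B) + η • (W - U) + (β ^ 2 * η * l) • (W - U)
      = ((α ^ 2 - β ^ 2) * l) • (ut + ν • l • U) - (B - BU) := by
  rw [← hu] at hw
  linear_combination (norm := module) hw

lemma timeDeriv_helm_apply {L α t : ℝ} {u : ℝ → Coeff} {K : Fin 3 → ℤ}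
    (h : HasDerivAt (fun s => u s K) (timeDeriv u t K) t) :
    timeDeriv (fun s => helm L α (u s)) t K
      = timeDeriv u t K + α ^ 2 • lam L K • timeDeriv u t K :=
  (h.add ((h.const_smul (lam L K)).const_smul (α ^ 2))).deriv

/-- The sum of the four terms of the error representation. -/
def errorTerms (L ν : ℝ) (N : ℕ) (u w : ℝ → Coeff) (s : ℝ) : ℝ :=
  sInner L 0 (proj N (bilin L ((w s - u s) - proj N (w s - u s)) (w s))) (resid L ν N u s)
    + sInner L 0 (proj N (bilin L (w s) ((w s - u s) - proj N (w s - u s)))) (resid L ν N u s)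
    + sInner L 0 (proj N (bilin L (proj N (w s - u s) - (w s - u s)) (proj N (w s - u s))))
      (resid L ν N u s)
    + sInner L 0 (proj N (bilin L (w s - u s) (proj N (w s - u s) - (w s - u s))))
      (resid L ν N u s)

lemma sInner_add_left {S : Finset (Fin 3 → ℤ)} {r : Coeff} (hS : ∀ K ∉ S, r K = 0) (L : ℝ) (s : ℕ)
    (X Y : Coeff) : sInner L s (X + Y) r = sInner L s X r + sInner L s Y r := by
  simp only [sInner_eq_sum hS, Pi.add_apply, inner_add_right, Complex.add_re, mul_add,
    Finset.sum_add_distrib]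

lemma errorTerms_eq {L ν : ℝ} {N : ℕ} {u w : ℝ → Coeff} {s : ℝ} (hu : u s ∈ VSpace 1)
    (hw : w s ∈ VSpace 1) :
    errorTerms L ν N u w s = sInner L 0
      (bilin L (w s - proj N (w s - u s)) (w s - proj N (w s - u s)) - bilin L (u s) (u s))
      (resid L ν N u s) := by
  have hS : ∀ K ∉ lowModes N, resid L ν N u s K = 0 := fun K hK => resid_eq_zero_of_notMem hK s
  rw [← bilin_splitting L hu hw (VSpace.proj N (VSpace.sub hw hu)), sInner_add_left hS,
    sInner_add_left hS, sInner_add_left hS, errorTerms]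
  simp only [sInner_proj_left fun K hK Y => proj_apply_of_resid_ne_zero hK Y]

/-- The integrand of the parameter update. -/
def updateIntegrand (L ν β η : ℝ) (N : ℕ) (u w : ℝ → Coeff) (s : ℝ) : ℝ :=
  sInner L 0 (timeDeriv (fun s => proj N (w s - u s)) s) (resid L ν N u s)
    + β ^ 2 * sInner L 1 (timeDeriv (fun s => proj N (w s - u s)) s) (resid L ν N u s)
    + ν * sInner L 1 (proj N (w s - u s)) (resid L ν N u s)
    + ν * β ^ 2 * sInner L 1 (stokes L (proj N (w s - u s))) (resid L ν N u s)
    + sInner L 0 (proj N (bilin L (w s) (w s))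
        - proj N (bilin L (w s - proj N (w s - u s)) (w s - proj N (w s - u s))))
      (resid L ν N u s)
    + η * sInner L 0 (proj N (w s - u s)) (resid L ν N u s)
    + β ^ 2 * η * sInner L 1 (proj N (w s - u s)) (resid L ν N u s)

lemma updatedBetaSq_eq (L ν β η : ℝ) (N : ℕ) (u w : ℝ → Coeff) (τ T : ℝ) :
    updatedBetaSq L ν β η N u w τ T = β ^ 2 + 1 / delta L ν N u τ T *
      ∫ s in τ..T, updateIntegrand L ν β η N u w s := rfl

lemma ae_updateIntegrand_eq {L ν α β η : ℝ} {N : ℕ} {f u w : ℝ → Coeff} {a b : ℝ} (hL : 0 < L)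
    (hab : a ≤ b) (hu : IsBardinaSolution L ν α f a b u)
    (hw : IsNudgedSolution L ν β η N f u a b w) :
    ∀ᵐ s ∂volume.restrict (Set.Icc a b), updateIntegrand L ν β η N u w s
      = (α ^ 2 - β ^ 2) * sNorm L 1 (resid L ν N u s) ^ 2 - errorTerms L ν N u w s := by
  filter_upwards [hu.eqn, hw.eqn, hu.regular.ae_hasDerivAt hab, hw.regular.ae_hasDerivAt hab,
    ae_restrict_mem measurableSet_Icc] with s hus hws hdu hdw hs
  have huV := hu.regular.mem_V s hs
  have hwV := hw.regular.mem_V s hs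
  have hS : ∀ K ∉ lowModes N, resid L ν N u s K = 0 := fun K hK => resid_eq_zero_of_notMem hK s
  rw [errorTerms_eq huV hwV, sNorm_sq_eq_sum hS hL, updateIntegrand]
  simp only [sInner_eq_sum hS, mul_left_comm _ (L ^ 3), ← mul_add, ← mul_sub, Finset.mul_sum,
    ← Finset.sum_add_distrib, ← Finset.sum_sub_distrib]
  refine Finset.sum_congr rfl fun K _ => ?_
  congr 1
  by_cases hr : resid L ν N u s K = 0
  · simp [hr]
  have hP : ∀ X : Coeff, proj N X K = X K := proj_apply_of_resid_ne_zero hr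
  have hrK : timeDeriv u s K + ν • lam L K • u s K = resid L ν N u s K :=
    (hP (timeDeriv u s + ν • stokes L (u s))).symm
  have hdg : timeDeriv (fun s => proj N (w s - u s)) s K = timeDeriv w s K - timeDeriv u s K := by
    simp only [timeDeriv, hP]
    exact ((hdw K).sub (hdu K)).deriv
  rw [leray_of_mem (VSpace.sub (VSpace.proj N hwV) (VSpace.proj N huV))] at hws
  have h1 : (timeDeriv u s K + α ^ 2 • lam L K • timeDeriv u s K)
      + ν • lam L K • (u s K + α ^ 2 • lam L K • u s K) + bilin L (u s) (u s) K = f s K := by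
    rw [← timeDeriv_helm_apply (hdu K)]; exact congrFun hus K
  have h2 : (timeDeriv w s K + β ^ 2 • lam L K • timeDeriv w s K)
      + ν • lam L K • (w s K + β ^ 2 • lam L K • w s K) + bilin L (w s) (w s) K
        = f s K - η • ((w s K - u s K) + β ^ 2 • lam L K • (w s K - u s K)) := by
    rw [← timeDeriv_helm_apply (hdw K)]
    have := congrFun hws K
    simp only [Pi.add_apply, Pi.sub_apply, Pi.smul_apply, helm, stokes, hP] at this ⊢
    exact this
  have h3 := congrArg (fun x => (inner ℂ (resid L ν N u s K) x).re) (mode_balance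
    (B := bilin L (w s - proj N (w s - u s)) (w s - proj N (w s - u s)) K) h1 h2)
  rw [hrK] at h3
  simp only [inner_add_right, inner_sub_right, Complex.add_re, Complex.sub_re,
    re_inner_real_smul] at h3
  have h4 : (inner ℂ (resid L ν N u s K) (resid L ν N u s K)).re = ‖resid L ν N u s K‖ ^ 2 := by
    rw [inner_self_eq_norm_sq_to_K]; norm_cast
  rw [h4] at h3
  simp only [hdg, hP, stokes, Pi.sub_apply, inner_sub_right, Complex.sub_re, re_inner_real_smul,
    pow_zero, pow_one, one_mul]
  linear_combination h3

/-! ### The error estimate -/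

lemma abs_errorTerms_le {L ν c : ℝ} {N : ℕ} {u w : ℝ → Coeff} {s : ℝ} (hL : 0 < L) (hN : 0 < N)
    (hc : IsGagliardoNirenbergConst L c) (hu : u s ∈ VSpace 1) (hw : w s ∈ VSpace 1)
    (hr : resid L ν N u s ∈ VSpace 1) :
    |errorTerms L ν N u w s| ≤ 4 * c ^ 2 * lam1 L ^ (-(1 / 4) : ℝ) / (N : ℝ) ^ (1 / 2 : ℝ)
      * ((sNorm L 1 (w s) + sNorm L 1 (u s)) * sNorm L 1 (w s - u s))
      * sNorm L 1 (resid L ν N u s) := by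
  have hS : ∀ K ∉ lowModes N, resid L ν N u s K = 0 := fun K hK => resid_eq_zero_of_notMem hK s
  unfold errorTerms
  simp only [sInner_proj_left fun K hK Y => proj_apply_of_resid_ne_zero hK Y]
  have hg : w s - u s ∈ VSpace 1 := VSpace.sub hw hu
  have hgle := sNorm_sub_le hL hw hu
  generalize resid L ν N u s = r at *
  generalize w s - u s = g at *
  have hp := VSpace.proj N hg
  have hple : sNorm L 1 (proj N g) ≤ sNorm L 1 g := sNorm_mono hL hg (norm_proj_le N g)
  have hq := interpolation_sub_proj_le hL hN hg
  have hq' := hq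
  rw [sNorm_sub_comm, sNorm_sub_comm L 1] at hq'
  have t1 := abs_sInner_bilin_le_left hL hc (VSpace.sub hg hp) hw hr hS
  have t2 := abs_sInner_bilin_le_right hL hc hw (VSpace.sub hg hp) hr hS
  have t3 := abs_sInner_bilin_le_left hL hc (VSpace.sub hp hg) hp hr hS
  have t4 := abs_sInner_bilin_le_right hL hc hg (VSpace.sub hp hg) hr hS
  have hκ : 0 ≤ lam1 L ^ (-(1 / 4) : ℝ) / (N : ℝ) ^ (1 / 2 : ℝ) :=
    div_nonneg (Real.rpow_nonneg (lam1_pos hL).le _) (Real.rpow_nonneg (Nat.cast_nonneg _) _)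
  rw [mul_div_assoc]
  generalize lam1 L ^ (-(1 / 4) : ℝ) / (N : ℝ) ^ (1 / 2 : ℝ) = κ at *
  have hg0 := sNorm_nonneg L 1 g
  have hr0 := sNorm_nonneg L 1 r
  have hw0 := sNorm_nonneg L 1 (w s)
  have hu0 := sNorm_nonneg L 1 (u s)
  have hp0 := sNorm_nonneg L 1 (proj N g)
  have bound : ∀ {I Q z : ℝ}, |I| ≤ c ^ 2 * Q * z * sNorm L 1 r → Q ≤ κ * sNorm L 1 g →
      0 ≤ z → z ≤ sNorm L 1 (w s) + sNorm L 1 (u s) →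
      |I| ≤ c ^ 2 * (κ * sNorm L 1 g) * (sNorm L 1 (w s) + sNorm L 1 (u s)) * sNorm L 1 r :=
    fun h1 h2 h3 h4 => h1.trans (by gcongr)
  have b1 := bound t1 hq hw0 (by linarith)
  have b2 := bound t2 hq hw0 (by linarith)
  have b3 := bound t3 hq' hp0 (by linarith)
  have b4 := bound t4 hq' hg0 (by linarith)
  refine ((abs_add_le _ _).trans (add_le_add_left ((abs_add_le _ _).trans
    (add_le_add_left (abs_add_le _ _) _)) _)).trans ?_
  linarith

lemma integral_le_sqrt_integral_sq {x : ℝ → ℝ} {τ T : ℝ} (hτT : τ < T)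
    (hx : IntervalIntegrable x volume τ T)
    (hx2 : IntervalIntegrable (fun s => x s ^ 2) volume τ T)
    (hpos : 0 < ∫ s in τ..T, x s ^ 2) :
    ∫ s in τ..T, x s ≤ Real.sqrt ((∫ s in τ..T, x s ^ 2) * (T - τ)) := by
  set δ := ∫ s in τ..T, x s ^ 2 with hδ
  have hT : 0 < T - τ := sub_pos.2 hτT
  set ε := Real.sqrt ((T - τ) / δ) with hε
  have hε0 : 0 < ε := Real.sqrt_pos.2 (by positivity)
  have h1 : ∫ s in τ..T, x s ≤ ∫ s in τ..T, (ε / 2 * x s ^ 2 + 1 / (2 * ε)) := by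
    refine intervalIntegral.integral_mono_on hτT.le hx
      ((hx2.const_mul _).add intervalIntegrable_const) fun s _ => ?_
    have h2 : ε / 2 * x s ^ 2 + 1 / (2 * ε) - x s = (ε * x s - 1) ^ 2 / (2 * ε) := by
      field_simp; ring
    have h3 : 0 ≤ (ε * x s - 1) ^ 2 / (2 * ε) := by positivity
    linarith
  rw [intervalIntegral.integral_add (hx2.const_mul _) intervalIntegrable_const,
    intervalIntegral.integral_const_mul, intervalIntegral.integral_const, ← hδ, smul_eq_mul] at h1
  refine h1.trans (le_of_eq ?_)
  have h4 : ε ^ 2 = (T - τ) / δ := Real.sq_sqrt (by positivity)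
  have h5 : T - τ = ε ^ 2 * δ := by rw [h4]; field_simp
  rw [h5, show δ * (ε ^ 2 * δ) = (ε * δ) ^ 2 by ring, Real.sqrt_sq (by positivity)]
  field_simp
  ring

lemma aestronglyMeasurable_errorTerms {L ν a b : ℝ} {N : ℕ} {u w : ℝ → Coeff} (hab : a ≤ b)
    (hu : IsRegular L a b u) (hw : IsRegular L a b w) :
    AEStronglyMeasurable (errorTerms L ν N u w) (volume.restrict (Set.Icc a b)) := by
  have mu := hu.modeMeasurable hab
  have mw := hw.modeMeasurable hab
  have mr := hu.modeMeasurable_resid hab (ν := ν) (N := N)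
  have mg := mw.sub mu
  have mp := mg.proj N
  have huV : ∀ᵐ t ∂volume.restrict (Set.Icc a b), u t ∈ VSpace 1 :=
    (ae_restrict_mem measurableSet_Icc).mono hu.mem_V
  have hwV : ∀ᵐ t ∂volume.restrict (Set.Icc a b), w t ∈ VSpace 1 :=
    (ae_restrict_mem measurableSet_Icc).mono hw.mem_V
  have hgV : ∀ᵐ t ∂volume.restrict (Set.Icc a b), w t - u t ∈ VSpace 1 := by
    filter_upwards [huV, hwV] with t h1 h2 using VSpace.sub h2 h1
  have hpV : ∀ᵐ t ∂volume.restrict (Set.Icc a b), proj N (w t - u t) ∈ VSpace 1 :=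
    hgV.mono fun t h => VSpace.proj N h
  have hqV : ∀ᵐ t ∂volume.restrict (Set.Icc a b),
      (w t - u t) - proj N (w t - u t) ∈ VSpace 1 := by
    filter_upwards [hgV, hpV] with t h1 h2 using VSpace.sub h1 h2
  have hqV' : ∀ᵐ t ∂volume.restrict (Set.Icc a b),
      proj N (w t - u t) - (w t - u t) ∈ VSpace 1 := by
    filter_upwards [hgV, hpV] with t h1 h2 using VSpace.sub h2 h1
  have hS : ∀ t, ∀ K ∉ lowModes N, resid L ν N u t K = 0 :=
    fun t K hK => resid_eq_zero_of_notMem hK t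
  have m1 := (((mg.sub mp).bilin mw hqV hwV L).proj N).sInner mr hS L 0
  have m2 := ((mw.bilin (mg.sub mp) hwV hqV L).proj N).sInner mr hS L 0
  have m3 := (((mp.sub mg).bilin mp hqV' hpV L).proj N).sInner mr hS L 0
  have m4 := ((mg.bilin (mp.sub mg) hgV hqV' L).proj N).sInner mr hS L 0
  exact ((m1.add m2).add m3).add m4

lemma sub_updatedBetaSq_eq {L ν α β η : ℝ} {N : ℕ} {f u w : ℝ → Coeff} {a τ T : ℝ}
    (hL : 0 < L) (haτ : a ≤ τ) (hτT : τ < T) (hu : IsBardinaSolution L ν α f a T u)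
    (hw : IsNudgedSolution L ν β η N f u a T w) (hδ : 0 < delta L ν N u τ T)
    (hint : IntervalIntegrable (fun s => sNorm L 1 (resid L ν N u s) ^ 2) volume τ T)
    (herr : IntervalIntegrable (errorTerms L ν N u w) volume τ T) :
    α ^ 2 - updatedBetaSq L ν β η N u w τ T
      = (delta L ν N u τ T)⁻¹ * ∫ s in τ..T, errorTerms L ν N u w s := by
  have h1 : ∫ s in τ..T, updateIntegrand L ν β η N u w s
      = ∫ s in τ..T, ((α ^ 2 - β ^ 2) * sNorm L 1 (resid L ν N u s) ^ 2
        - errorTerms L ν N u w s) := by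
    rw [intervalIntegral.integral_of_le hτT.le, intervalIntegral.integral_of_le hτT.le]
    refine integral_congr_ae (ae_restrict_of_ae_restrict_of_subset ?_
      (ae_updateIntegrand_eq hL (haτ.trans hτT.le) hu hw))
    exact fun s hs => ⟨haτ.trans hs.1.le, hs.2⟩
  rw [updatedBetaSq_eq, h1, intervalIntegral.integral_sub (hint.const_mul _) herr,
    intervalIntegral.integral_const_mul]
  change _ - (_ + _ * (_ * delta L ν N u τ T - _)) = _
  field_simp
  ring

end Bardina

end

theorem proposition5p6
    (L ν α β η c : ℝ) (N : ℕ) (hL : 0 < L) (hν : 0 < ν) (hα : 0 < α) (hβ : 0 < β) (hη : 0 < η)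
    (hc : IsGagliardoNirenbergConst L c)
    (f : ℝ → Coeff) (hf : IsForcing L f)
    (a τ T : ℝ) (ha : 0 ≤ a) (haτ : a ≤ τ) (hτT : τ < T)
    (u w : ℝ → Coeff)
    (hu : IsBardinaSolution L ν α f a T u)
    (hw : IsNudgedSolution L ν β η N f u a T w)
    (hδ : 0 < delta L ν N u τ T) :
    |α ^ 2 - updatedBetaSq L ν β η N u w τ T| ≤
      4 * c ^ 2 * lam1 L ^ (-(1 / 4) : ℝ)
        / ((delta L ν N u τ T / (T - τ)) ^ (1 / 2 : ℝ) * (N : ℝ) ^ (1 / 2 : ℝ))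
        * sSup ((fun s => (sNorm L 1 (w s) + sNorm L 1 (u s)) * sNorm L 1 (w s - u s)) ''
            Set.Icc τ T) ∧
    α ^ 2 - updatedBetaSq L ν β η N u w τ T =
      (delta L ν N u τ T)⁻¹ * ∫ s in τ..T,
        (sInner L 0 (proj N (bilin L ((w s - u s) - proj N (w s - u s)) (w s)))
            (resid L ν N u s)
          + sInner L 0 (proj N (bilin L (w s) ((w s - u s) - proj N (w s - u s))))
            (resid L ν N u s)
          + sInner L 0 (proj N (bilin L (proj N (w s - u s) - (w s - u s)) (proj N (w s - u s))))
            (resid L ν N u s)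
          + sInner L 0 (proj N (bilin L (w s - u s) (proj N (w s - u s) - (w s - u s))))
            (resid L ν N u s)) := by
  have haT : a ≤ T := haτ.trans hτT.le
  have hsub : Set.Ioc τ T ⊆ Set.Icc a T := fun s hs => ⟨haτ.trans hs.1.le, hs.2⟩
  have hsub' : Set.Icc τ T ⊆ Set.Icc a T := Set.Icc_subset_Icc_left haτ
  have hN : 0 < N := by
    refine Nat.pos_of_ne_zero fun h => hδ.ne' ?_
    have h0 : ∀ s, resid L ν N u s = 0 := fun s => by
      subst h
      funext K
      exact if_neg fun h => absurd (h.1.trans h.2) (by simp)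
    simp [delta, h0, sNorm]
  have hint : IntervalIntegrable (fun s => sNorm L 1 (resid L ν N u s) ^ 2)
      MeasureTheory.volume τ T := by
    by_contra h
    exact hδ.ne' (intervalIntegral.integral_undef h)
  have hint1 : IntervalIntegrable (fun s => sNorm L 1 (resid L ν N u s))
      MeasureTheory.volume τ T := by
    rw [intervalIntegrable_iff_integrableOn_Ioc_of_le hτT.le] at hint ⊢
    refine (hint.add (MeasureTheory.integrable_const (1 : ℝ))).mono' ?_
      (Filter.Eventually.of_forall fun s => ?_)
    · have := Real.continuous_sqrt.comp_aestronglyMeasurable hint.1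
      simpa only [Real.sqrt_sq (sNorm_nonneg _ _ _)] using this
    · rw [Real.norm_of_nonneg (sNorm_nonneg _ _ _)]
      simp only [Pi.add_apply]
      nlinarith [sq_nonneg (sNorm L 1 (resid L ν N u s) - 1)]
  set Φ : ℝ → ℝ := fun s => (sNorm L 1 (w s) + sNorm L 1 (u s)) * sNorm L 1 (w s - u s) with hΦ
  set M := sSup (Φ '' Set.Icc τ T) with hM
  have hbdd : BddAbove (Φ '' Set.Icc τ T) := by
    obtain ⟨Cu, hCu⟩ := (isCompact_Icc.image_of_continuousOn
      (hu.regular.continuousOn_sNorm hL)).bddAbove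
    obtain ⟨Cw, hCw⟩ := (isCompact_Icc.image_of_continuousOn
      (hw.regular.continuousOn_sNorm hL)).bddAbove
    refine ⟨(Cw + Cu) * (Cw + Cu), ?_⟩
    rintro _ ⟨s, hs, rfl⟩
    have h1 := hCu ⟨s, hsub' hs, rfl⟩
    have h2 := hCw ⟨s, hsub' hs, rfl⟩
    have h3 := sNorm_sub_le hL (hw.regular.mem_V s (hsub' hs)) (hu.regular.mem_V s (hsub' hs))
    have h4 := sNorm_nonneg L 1 (w s)
    have h5 := sNorm_nonneg L 1 (u s)
    exact mul_le_mul (by simp only at h1 h2; linarith) (by simp only at h1 h2; linarith)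
      (sNorm_nonneg _ _ _) (by simp only at h1 h2; linarith)
  have hM0 : 0 ≤ M := by
    refine le_trans ?_ (le_csSup hbdd ⟨τ, Set.left_mem_Icc.2 hτT.le, rfl⟩)
    exact mul_nonneg (add_nonneg (sNorm_nonneg _ _ _) (sNorm_nonneg _ _ _)) (sNorm_nonneg _ _ _)
  set κ := 4 * c ^ 2 * lam1 L ^ (-(1 / 4) : ℝ) / (N : ℝ) ^ (1 / 2 : ℝ) with hκ
  have hκ0 : 0 ≤ κ := by
    have := lam1_pos hL
    positivity
  have hbound : ∀ᵐ s ∂MeasureTheory.volume.restrict (Set.Ioc τ T),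
      ‖errorTerms L ν N u w s‖ ≤ κ * M * sNorm L 1 (resid L ν N u s) := by
    filter_upwards [MeasureTheory.ae_restrict_of_ae_restrict_of_subset hsub hu.regular.ae_resid_mem,
      MeasureTheory.ae_restrict_mem measurableSet_Ioc] with s hr hs
    refine (abs_errorTerms_le hL hN hc (hu.regular.mem_V s (hsub hs))
      (hw.regular.mem_V s (hsub hs)) hr).trans ?_
    have := le_csSup hbdd ⟨s, Set.Ioc_subset_Icc_self hs, rfl⟩
    exact mul_le_mul_of_nonneg_right (mul_le_mul_of_nonneg_left this hκ0) (sNorm_nonneg _ _ _)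
  have herr : IntervalIntegrable (errorTerms L ν N u w) MeasureTheory.volume τ T := by
    rw [intervalIntegrable_iff_integrableOn_Ioc_of_le hτT.le] at hint1 ⊢
    exact (hint1.const_mul (κ * M)).mono'
      ((aestronglyMeasurable_errorTerms haT hu.regular hw.regular).mono_measure
        (MeasureTheory.Measure.restrict_mono hsub le_rfl)) hbound
  have hrep := sub_updatedBetaSq_eq hL haτ hτT hu hw hδ hint herr
  refine ⟨?_, hrep⟩
  have hI : |∫ s in τ..T, errorTerms L ν N u w s|
      ≤ κ * M * Real.sqrt (delta L ν N u τ T * (T - τ)) := by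
    rw [← Real.norm_eq_abs]
    refine (intervalIntegral.norm_integral_le_of_norm_le hτT.le
      ((MeasureTheory.ae_restrict_iff' measurableSet_Ioc).1 hbound) (hint1.const_mul _)).trans ?_
    rw [intervalIntegral.integral_const_mul]
    exact mul_le_mul_of_nonneg_left (integral_le_sqrt_integral_sq hτT hint1 hint hδ)
      (mul_nonneg hκ0 hM0)
  have hT : 0 < T - τ := sub_pos.2 hτT
  rw [hrep, abs_mul, abs_of_pos (inv_pos.2 hδ)]
  refine (mul_le_mul_of_nonneg_left hI (inv_pos.2 hδ).le).trans (le_of_eq ?_)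
  rw [← Real.sqrt_eq_rpow (delta L ν N u τ T / (T - τ)), Real.sqrt_div hδ.le,
    Real.sqrt_mul hδ.le, hκ]
  have hs1 := Real.sqrt_pos.2 hδ
  have hs2 := Real.sqrt_pos.2 hT
  have hs3 : delta L ν N u τ T
    = Real.sqrt (delta L ν N u τ T) * Real.sqrt (delta L ν N u τ T) :=
    (Real.mul_self_sqrt hδ.le).symm
  have hN' : 0 < (N : ℝ) ^ (1 / 2 : ℝ) := by positivity
  nth_rewrite 1 [hs3]
  field_simp
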